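/- **Definitions.** Let $G=(V,E)$ be a finite graph, $p\in(0,1)$ and $q>1$. A random-cluster configuration is a subset $A\subseteq E$, and the random-cluster measure is $$\mu(A)=\mu_{G,p,q}(A)=\frac1Z\,p^{|A|}(1-p)^{|E|-|A|}q^{c(A)},$$ where $c(A)$ is the number of connected components of $(V,A)$ and $Z$ is the normalizing constant. One step of the (heat-bath) *Glauber dynamics* (GD) from $A$ picks $e\in E$ uniformly at random and moves to $A\cup\{e\}$ with probability $\frac{\mu(A\cup\{e\})}{\mu(A\cup\{e\})+\mu(A\setminus\{e\})}$, and otherwise to $A\setminus\{e\}$. One step of the *Chayes–Machta dynamics* (CM) from $A$ activates each connected component of $(V,A)$ independently with probability $1/q$ (a vertex is active if its component is), removes all edges of $A$ joining two active vertices, and then adds each edge of $G$ joining two active vertices independently with probability $p$, leaving the rest of the configuration unchanged. For either chain, with transition matrix $P$, the mixing time is $\tau_{\rm mix}=\max_{A}\min\{t\ge 0:\|P^t(A,\cdot)-\mu\|_{\rm TV}\le 1/4\}$. **Theorem.** On the complete $n$-vertex graph with $p=\lambda/n$, for all $q>1$ and all $\lambda=O(1)$, the mixing times $\tau_{\rm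 mix}^{\rm GD}$ and $\tau_{\rm mix}^{\rm CM}$ satisfy $$\tau_{\rm mix}^{\rm GD}\le \tau_{\rm mix}^{\rm CM}\cdot O\big(n^3(\log n)^2\big).$$ That is, for every $q>1$ and $\Lambda>0$ there are a constant $C>0$ and an integer $N$, depending only on $q$ and $\Lambda$, such that for all $n\ge N$ and all $\lambda$ with $0<\lambda\le\Lambda$ and $\lambda<n$, $$\tau_{\rm mix}^{\rm GD}\le C\,n^3(\log n)^2\cdot\tau_{\rm mix}^{\rm CM}.$$ -/

import Mathlib

open scoped ENNReal

namespace RandomCluster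

section Mixing

variable {Ω : Type*} [Fintype Ω]

/-- Total variation distance between two (mass functions of) distributions on a finite set. -/
noncomputable def tvDist (μ ν : Ω → ℝ) : ℝ := (1 / 2) * ∑ x, |μ x - ν x|

/-- The `ε`-mixing time `max_x min {t ≥ 0 : ‖P^t(x,·) - π‖_TV ≤ ε}` of the chain with transition
matrix `P` and stationary distribution `π`. The minimum over an empty set of times is `⊤`. -/
noncomputable def mixingTime [DecidableEq Ω] (P : Matrix Ω Ω ℝ) (π : Ω → ℝ) (ε : ℝ) : ℕ∞ :=
  ⨆ x : Ω, ⨅ (t : ℕ) (_ : tvDist ((P ^ t) x) π ≤ ε), (t : ℕ∞)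

end Mixing

section Model

variable {V : Type*} [Fintype V] [DecidableEq V] (G : SimpleGraph V) [DecidableRel G.Adj]

/-- Random-cluster configurations on `G`: all subsets of the edge set. -/
abbrev Config : Type _ := Finset G.edgeSet

variable {G}

/-- The spanning subgraph `(V, A)`. -/
def Config.graph (A : Config G) : SimpleGraph V :=
  SimpleGraph.fromEdgeSet {e | ∃ h : e ∈ G.edgeSet, (⟨e, h⟩ : G.edgeSet) ∈ A}

/-- The number `c(A)` of connected components of `(V, A)`. -/
noncomputable def Config.numComponents (A : Config G) : ℕ :=
  Nat.card A.graph.ConnectedComponent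

variable (G)

/-- The unnormalized weight `p^|A| (1-p)^(|E|-|A|) q^c(A)`. -/
noncomputable def weight (p q : ℝ) (A : Config G) : ℝ :=
  p ^ A.card * (1 - p) ^ (Fintype.card G.edgeSet - A.card) * q ^ A.numComponents

/-- The partition function. -/
noncomputable def partitionFunction (p q : ℝ) : ℝ := ∑ A : Config G, weight G p q A

/-- The random-cluster (Gibbs) measure `μ_{G,p,q}`. -/
noncomputable def gibbs (p q : ℝ) (A : Config G) : ℝ := weight G p q A / partitionFunction G p q

/-- The probability that the heat-bath update of `e` in configuration `A` makes `e` present. -/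
noncomputable def heatBathProb (p q : ℝ) (A : Config G) (e : G.edgeSet) : ℝ :=
  gibbs G p q (insert e A) / (gibbs G p q (insert e A) + gibbs G p q (A.erase e))

/-- The transition matrix of the heat-bath Glauber dynamics: pick an edge `e` uniformly at random,
move to `A ∪ {e}` with the heat-bath probability, else to `A \ {e}`. -/
noncomputable def glauber (p q : ℝ) : Matrix (Config G) (Config G) ℝ := fun A B =>
  ∑ e : G.edgeSet, (1 / (Fintype.card G.edgeSet : ℝ)) *
    ((if B = insert e A then heatBathProb G p q A e else 0) +
      (if B = A.erase e then 1 - heatBathProb G p q A e else 0))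

variable {G} in
open Classical in
/-- The edges of `G` both of whose endpoints are active, when the active components of `(V, A)`
are those in `S`. -/
noncomputable def activeEdges (A : Config G) (S : Finset A.graph.ConnectedComponent) :
    Finset G.edgeSet :=
  Finset.univ.filter fun e => ∀ v ∈ (e : Sym2 V), A.graph.connectedComponentMk v ∈ S

variable {G} in
/-- The probability that the percolation sub-step takes `A` to `B` when `F` is the set of edges of
`G` between active vertices: the edges in `F` are removed, then each edge of `F` is added
independently with probability `p`, and the edges outside `F` are left unchanged. -/
noncomputable def percolationProb (p : ℝ) (F : Finset G.edgeSet) (A B : Config G) : ℝ :=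
  if B \ F = A \ F then p ^ (F ∩ B).card * (1 - p) ^ (F \ B).card else 0

open Classical in
/-- The transition matrix of the Chayes-Machta dynamics: each connected component of `(V, A)` is
activated independently with probability `1 / q` (`S` is the set of activated components), then
the percolation sub-step is performed. -/
noncomputable def chayesMachta (p q : ℝ) : Matrix (Config G) (Config G) ℝ := fun A B =>
  ∑ S : Finset A.graph.ConnectedComponent,
    (1 / q) ^ S.card * (1 - 1 / q) ^ Sᶜ.card * percolationProb p (activeEdges A S) A B

/-- Mixing time of the Glauber dynamics on `G`. -/
noncomputable def mixingTimeGD (p q : ℝ) : ℕ∞ :=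
  mixingTime (glauber G p q) (gibbs G p q) (1 / 4)

/-- Mixing time of the Chayes-Machta dynamics on `G`. -/
noncomputable def mixingTimeCM (p q : ℝ) : ℕ∞ :=
  mixingTime (chayesMachta G p q) (gibbs G p q) (1 / 4)

end Model

end RandomCluster

/-!
Given the set `U` of active vertices, a Chayes-Machta step re-randomises the edges inside `U` as
independent Bernoulli(`p`) variables, so it is a conditional expectation, and the Efron-Stein
inequality bounds the energy it dissipates by the sum over these edges of the variances under
resampling a single edge. An edge resampled with probability `p` contributes variance `p (1 - p)`,
the heat-bath update with probability `h` contributes `h (1 - h)`, and the ratio is at most `q`; so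
the Dirichlet form of the Chayes-Machta dynamics is at most `q |E|` times that of the Glauber
dynamics. A reversible chain that mixes in time `k` satisfies a Poincaré inequality with constant
`O(k)`, which therefore passes to the Glauber dynamics with constant `O(k q |E|)`.

Going back from a Poincaré inequality to a mixing time costs a factor `log (1 / μ(A))` for the
starting configuration `A`. In the worst case this is of order `n ^ 2 log n`, but after a burn-in
of `O(|E| log n)` Glauber steps the expected number of open edges is `O(p |E|) = O(n)`, and for such
`A` the factor is only `O(n log n)`.
-/

namespace RandomCluster

open Finset Matrix
open scoped BigOperators

section WeightedInner

variable {Ω : Type*} [Fintype Ω] {w : Ω → ℝ}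

theorem wInner_eq_sum (w f g : Ω → ℝ) : ⟪f, g⟫_[ℝ, w] = ∑ x, w x * (f x * g x) := by
  simp [RCLike.wInner, mul_comm]

theorem wInner_comm (w f g : Ω → ℝ) : ⟪f, g⟫_[ℝ, w] = ⟪g, f⟫_[ℝ, w] := by
  simp only [wInner_eq_sum, mul_comm]

theorem wInner_self_nonneg (hw : ∀ x, 0 ≤ w x) (f : Ω → ℝ) : 0 ≤ ⟪f, f⟫_[ℝ, w] := by
  rw [wInner_eq_sum]
  exact sum_nonneg fun x _ => mul_nonneg (hw x) (mul_self_nonneg _)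

theorem two_mul_wInner_le (hw : ∀ x, 0 ≤ w x) (f g : Ω → ℝ) :
    2 * ⟪f, g⟫_[ℝ, w] ≤ ⟪f, f⟫_[ℝ, w] + ⟪g, g⟫_[ℝ, w] := by
  have h := wInner_self_nonneg hw (f - g)
  simp only [RCLike.wInner_sub_left, RCLike.wInner_sub_right, wInner_comm w g f] at h
  linarith

theorem sq_sum_mul_abs_le (hw : ∀ x, 0 ≤ w x) (hw1 : ∑ x, w x = 1) (f : Ω → ℝ) :
    (∑ x, w x * |f x|) ^ 2 ≤ ⟪f, f⟫_[ℝ, w] := by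
  rw [wInner_eq_sum]
  simpa only [sq_abs, ← sq] using
    Real.pow_arith_mean_le_arith_mean_pow_of_even univ w (|f ·|) (fun x _ => hw x) hw1 even_two

-- The Schur test for a symmetric kernel.
theorem sum_sum_mul_le_of_symm {K : Ω → Ω → ℝ} {c : ℝ} (hK : ∀ x y, K x y = K y x)
    (hrow : ∀ x, ∑ y, |K x y| ≤ c * w x) (f : Ω → ℝ) :
    ∑ x, ∑ y, K x y * (f x * f y) ≤ c * ⟪f, f⟫_[ℝ, w] := by
  have entry (x y : Ω) :
      K x y * (f x * f y) ≤ 1 / 2 * (|K x y| * f x ^ 2) + 1 / 2 * (|K y x| * f y ^ 2) := by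
    have h := mul_le_mul_of_nonneg_left (two_mul_le_add_sq |f x| |f y|) (abs_nonneg (K x y))
    have h' := le_abs_self (K x y * (f x * f y))
    rw [abs_mul, abs_mul] at h'
    rw [hK y x, ← sq_abs (f x), ← sq_abs (f y)]
    linarith
  have row : ∑ x, ∑ y, |K x y| * f x ^ 2 ≤ c * ⟪f, f⟫_[ℝ, w] := by
    rw [wInner_eq_sum, mul_sum]
    refine sum_le_sum fun x _ => ?_
    rw [← sum_mul, ← sq, ← mul_assoc]
    exact mul_le_mul_of_nonneg_right (hrow x) (sq_nonneg _)
  have col : ∑ x, ∑ y, |K y x| * f y ^ 2 = ∑ x, ∑ y, |K x y| * f x ^ 2 := sum_comm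
  refine (sum_le_sum fun x _ => sum_le_sum fun y _ => entry x y).trans ?_
  simp only [sum_add_distrib, ← mul_sum, col]
  linarith

end WeightedInner

section TotalVariation

variable {Ω : Type*} [Fintype Ω] {μ ν : Ω → ℝ}

theorem tvDist_le_one (hμ : ∀ x, 0 ≤ μ x) (hμ1 : ∑ x, μ x = 1) (hν : ∀ x, 0 ≤ ν x)
    (hν1 : ∑ x, ν x = 1) : tvDist μ ν ≤ 1 := by
  have h : ∑ x, |μ x - ν x| ≤ ∑ x, (μ x + ν x) :=
    sum_le_sum fun x _ =>
      (abs_sub _ _).trans_eq (by rw [abs_of_nonneg (hμ x), abs_of_nonneg (hν x)])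
  rw [sum_add_distrib, hμ1, hν1] at h
  unfold tvDist
  linarith

theorem tvDist_vecMul_le {Ω' : Type*} [Fintype Ω'] {w : Ω' → ℝ} (hw : ∀ x, 0 ≤ w x)
    (hw1 : ∑ x, w x = 1) (Q : Matrix Ω' Ω ℝ) (ν : Ω → ℝ) :
    tvDist (w ᵥ* Q) ν ≤ ∑ x, w x * tvDist (Q x) ν := by
  have h (y : Ω) : |(w ᵥ* Q) y - ν y| ≤ ∑ x, w x * |Q x y - ν y| := by
    have : (w ᵥ* Q) y - ν y = ∑ x, w x * (Q x y - ν y) := by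
      simp only [vecMul, dotProduct, mul_sub, sum_sub_distrib, ← sum_mul, hw1, one_mul]
    rw [this]
    exact (abs_sum_le_sum_abs _ _).trans_eq <| sum_congr rfl fun x _ => by
      rw [abs_mul, abs_of_nonneg (hw x)]
  simp only [tvDist, mul_left_comm _ (1 / 2 : ℝ), ← mul_sum]
  refine mul_le_mul_of_nonneg_left ((sum_le_sum fun y _ => h y).trans_eq ?_) (by norm_num)
  rw [sum_comm]
  simp only [mul_sum]

theorem tvDist_vecMul_vecMul_le [DecidableEq Ω] {P : Matrix Ω Ω ℝ} (hP : P ∈ rowStochastic ℝ Ω)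
    (μ ν : Ω → ℝ) : tvDist (μ ᵥ* P) (ν ᵥ* P) ≤ tvDist μ ν := by
  refine mul_le_mul_of_nonneg_left ?_ (by norm_num)
  calc ∑ y, |(μ ᵥ* P) y - (ν ᵥ* P) y|
      ≤ ∑ y, ∑ x, |μ x - ν x| * P x y := by
        refine sum_le_sum fun y _ => ?_
        rw [← Pi.sub_apply, ← sub_vecMul]
        refine (abs_sum_le_sum_abs _ _).trans_eq (sum_congr rfl fun x _ => ?_)
        rw [abs_mul, Pi.sub_apply, abs_of_nonneg (nonneg_of_mem_rowStochastic hP)]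
    _ = ∑ x, |μ x - ν x| := by
        rw [sum_comm]
        simp only [← mul_sum, sum_row_of_mem_rowStochastic hP, mul_one]

end TotalVariation

section RowStochastic

variable {Ω : Type*} [Fintype Ω] [DecidableEq Ω] {P : Matrix Ω Ω ℝ}

theorem mulVec_mono (hP : P ∈ rowStochastic ℝ Ω) {f g : Ω → ℝ} (hfg : ∀ x, f x ≤ g x) (x : Ω) :
    (P *ᵥ f) x ≤ (P *ᵥ g) x :=
  sum_le_sum fun y _ => mul_le_mul_of_nonneg_left (hfg y) (nonneg_of_mem_rowStochastic hP)

theorem mulVec_const (hP : P ∈ rowStochastic ℝ Ω) (c : ℝ) (x : Ω) : (P *ᵥ fun _ => c) x = c := by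
  simp only [mulVec, dotProduct, ← sum_mul, sum_row_of_mem_rowStochastic hP, one_mul]

theorem pow_mulVec_le_of_mulVec_le (hP : P ∈ rowStochastic ℝ Ω) {f : Ω → ℝ} {a : ℝ} (ha : 0 ≤ a)
    (hf : ∀ x, (P *ᵥ f) x ≤ a * f x) (t : ℕ) (x : Ω) : (P ^ t *ᵥ f) x ≤ a ^ t * f x := by
  induction t generalizing x with
  | zero => simp
  | succ t ih =>
    calc (P ^ (t + 1) *ᵥ f) x
        = (P *ᵥ (P ^ t *ᵥ f)) x := by rw [pow_succ', mulVec_mulVec]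
      _ ≤ (P *ᵥ (a ^ t • f)) x := mulVec_mono hP ih x
      _ = a ^ t * (P *ᵥ f) x := by rw [mulVec_smul, Pi.smul_apply, smul_eq_mul]
      _ ≤ a ^ t * (a * f x) := mul_le_mul_of_nonneg_left (hf x) (pow_nonneg ha t)
      _ = a ^ (t + 1) * f x := by rw [pow_succ, mul_assoc]

theorem tvDist_pow_add_le (hP : P ∈ rowStochastic ℝ Ω) (π : Ω → ℝ) (t s : ℕ) (x : Ω) :
    tvDist ((P ^ (t + s)) x) π ≤ (P ^ t *ᵥ fun y => tvDist ((P ^ s) y) π) x := by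
  have hPt := pow_mem hP t
  have hx : (P ^ (t + s)) x = (P ^ t) x ᵥ* P ^ s := by
    rw [pow_add]
    rfl
  rw [hx]
  exact tvDist_vecMul_le (fun _ => nonneg_of_mem_rowStochastic hPt)
    (sum_row_of_mem_rowStochastic hPt x) (P ^ s) π

end RowStochastic

section MixingTime

variable {Ω : Type*} [Fintype Ω] [DecidableEq Ω] {P : Matrix Ω Ω ℝ} {π : Ω → ℝ} {ε : ℝ}

theorem mixingTime_le_coe_iff {k : ℕ} :
    mixingTime P π ε ≤ k ↔ ∀ x, ∃ t ≤ k, tvDist ((P ^ t) x) π ≤ ε := by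
  simp only [mixingTime, iSup_le_iff, ← ENat.lt_natCast_add_one_iff, iInf_lt_iff]
  simp only [ENat.lt_natCast_add_one_iff, Nat.cast_le, exists_prop, and_comm]

theorem mixingTime_le {t : ℕ} (h : ∀ x, tvDist ((P ^ t) x) π ≤ ε) : mixingTime P π ε ≤ t :=
  mixingTime_le_coe_iff.2 fun x => ⟨t, le_rfl, h x⟩

theorem mixingTime_ne_zero [Nontrivial Ω] (hε : ε < 1 / 2) : mixingTime P π ε ≠ 0 := by
  intro h0
  have mixed (x : Ω) : ∑ z, |(1 : Matrix Ω Ω ℝ) x z - π z| < 1 := by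
    obtain ⟨t, ht, hx⟩ := mixingTime_le_coe_iff.1 (h0.le.trans_eq Nat.cast_zero.symm) x
    rw [Nat.le_zero.1 ht, pow_zero] at hx
    unfold tvDist at hx
    linarith
  obtain ⟨x, y, hxy⟩ := exists_pair_ne Ω
  have two_points (z : Ω) :
      |(1 : Matrix Ω Ω ℝ) z x - π x| + |(1 : Matrix Ω Ω ℝ) z y - π y| < 1 := by
    rw [← sum_pair hxy (f := fun w => |(1 : Matrix Ω Ω ℝ) z w - π w|)]
    exact (sum_le_sum_of_subset_of_nonneg (subset_univ _) fun _ _ _ => abs_nonneg _).trans_lt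
      (mixed z)
  have hx := two_points x
  have hy := two_points y
  rw [one_apply_eq, one_apply_ne hxy] at hx
  rw [one_apply_eq, one_apply_ne hxy.symm] at hy
  linarith [le_abs_self (1 - π x), neg_abs_le (0 - π x), le_abs_self (1 - π y),
    neg_abs_le (0 - π y)]

end MixingTime

section ReversibleChains

variable {Ω : Type*} [Fintype Ω]

/-- The Dirichlet form `⟨f, (I - P) f⟩_π` of the chain with transition matrix `P`. -/
noncomputable def dirichletForm (P : Matrix Ω Ω ℝ) (π f : Ω → ℝ) : ℝ :=
  ⟪f, f⟫_[ℝ, π] - ⟪f, P *ᵥ f⟫_[ℝ, π]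

/-- The Poincaré inequality with constant `K`: for a reversible chain, the spectral gap is at
least `1 / K`. -/
def PoincareInequality (P : Matrix Ω Ω ℝ) (π : Ω → ℝ) (K : ℝ) : Prop :=
  ∀ f : Ω → ℝ, ∑ x, π x * f x = 0 → ⟪f, f⟫_[ℝ, π] ≤ K * dirichletForm P π f

theorem wInner_mulVec (P : Matrix Ω Ω ℝ) (π f g : Ω → ℝ) :
    ⟪f, P *ᵥ g⟫_[ℝ, π] = ∑ x, ∑ y, π x * P x y * (f x * g y) := by
  simp only [wInner_eq_sum, mulVec, dotProduct, mul_sum]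
  exact sum_congr rfl fun x _ => sum_congr rfl fun y _ => by ring

theorem balance_of_wInner_mulVec_comm {P : Matrix Ω Ω ℝ} {π : Ω → ℝ}
    (h : ∀ f g, ⟪f, P *ᵥ g⟫_[ℝ, π] = ⟪P *ᵥ f, g⟫_[ℝ, π]) (x y : Ω) :
    π x * P x y = π y * P y x := by
  classical
  simpa [wInner_eq_sum, Pi.single_apply] using h (Pi.single x 1) (Pi.single y 1)

variable [DecidableEq Ω]

/-- `P` is the transition matrix of a chain that is reversible with respect to the probability
vector `π`. Positivity of `π` is included, so that no state is invisible to `L²(π)`. -/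
structure IsReversible (P : Matrix Ω Ω ℝ) (π : Ω → ℝ) : Prop where
  mem_rowStochastic : P ∈ rowStochastic ℝ Ω
  pos : ∀ x, 0 < π x
  sum_eq_one : ∑ x, π x = 1
  balance : ∀ x y, π x * P x y = π y * P y x

/-- The density of the point mass at `x` with respect to `π`, minus `1`; its `L²(π)` norm after `s`
steps of the chain controls the distance of the law of the chain started at `x` from `π`. -/
noncomputable def centeredDensity (π : Ω → ℝ) (x : Ω) : Ω → ℝ := Pi.single x (π x)⁻¹ - 1

namespace IsReversible

variable {P : Matrix Ω Ω ℝ} {π : Ω → ℝ}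

theorem vecMul_eq (h : IsReversible P π) : π ᵥ* P = π := by
  ext y
  simp only [vecMul, dotProduct, fun x => h.balance x y, ← mul_sum,
    sum_row_of_mem_rowStochastic h.mem_rowStochastic, mul_one]

theorem wInner_mulVec_comm (h : IsReversible P π) (f g : Ω → ℝ) :
    ⟪f, P *ᵥ g⟫_[ℝ, π] = ⟪P *ᵥ f, g⟫_[ℝ, π] := by
  rw [wInner_comm π (P *ᵥ f), wInner_mulVec, wInner_mulVec, sum_comm]
  exact sum_congr rfl fun x _ => sum_congr rfl fun y _ => by rw [h.balance, mul_comm (f y)]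

theorem sum_mul_mulVec (h : IsReversible P π) (f : Ω → ℝ) :
    ∑ x, π x * (P *ᵥ f) x = ∑ x, π x * f x :=
  (dotProduct_mulVec π P f).trans (by rw [h.vecMul_eq]; rfl)

theorem pow (h : IsReversible P π) (t : ℕ) : IsReversible (P ^ t) π where
  mem_rowStochastic := pow_mem h.mem_rowStochastic t
  pos := h.pos
  sum_eq_one := h.sum_eq_one
  balance := balance_of_wInner_mulVec_comm fun f g => by
    induction t generalizing f with
    | zero => simp
    | succ t ih =>
      rw [pow_succ', ← mulVec_mulVec, h.wInner_mulVec_comm, ih, mulVec_mulVec, ← pow_succ,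
        ← pow_succ']

theorem tvDist_antitone (h : IsReversible P π) (x : Ω) :
    Antitone fun t => tvDist ((P ^ t) x) π := by
  refine antitone_nat_of_succ_le fun t => ?_
  have hx : (P ^ (t + 1)) x = (P ^ t) x ᵥ* P := by
    rw [pow_succ]
    rfl
  conv_lhs => rw [hx, ← h.vecMul_eq]
  exact tvDist_vecMul_vecMul_le h.mem_rowStochastic _ _

theorem tvDist_le_of_mixingTime_le (h : IsReversible P π) {ε : ℝ} {k : ℕ}
    (hk : mixingTime P π ε ≤ k) (x : Ω) : tvDist ((P ^ k) x) π ≤ ε := by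
  obtain ⟨t, htk, ht⟩ := mixingTime_le_coe_iff.1 hk x
  exact (h.tvDist_antitone x htk).trans ht

theorem dirichletForm_nonneg (h : IsReversible P π) (f : Ω → ℝ) : 0 ≤ dirichletForm P π f := by
  rw [dirichletForm, sub_nonneg, wInner_mulVec, ← one_mul ⟪f, f⟫_[ℝ, π]]
  refine sum_sum_mul_le_of_symm h.balance (fun x => ?_) f
  simp only [abs_mul, abs_of_pos (h.pos x),
    abs_of_nonneg (nonneg_of_mem_rowStochastic h.mem_rowStochastic), ← mul_sum,
    sum_row_of_mem_rowStochastic h.mem_rowStochastic, mul_one, one_mul, le_refl]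

theorem wInner_mulVec_le_of_tvDist_le (h : IsReversible P π) {ε : ℝ}
    (hP : ∀ x, tvDist (P x) π ≤ ε) {f : Ω → ℝ} (hf : ∑ x, π x * f x = 0) :
    ⟪f, P *ᵥ f⟫_[ℝ, π] ≤ 2 * ε * ⟪f, f⟫_[ℝ, π] := by
  have centre : ⟪f, P *ᵥ f⟫_[ℝ, π] = ∑ x, ∑ y, π x * (P x y - π y) * (f x * f y) := by
    have h0 : ∑ x, ∑ y, π x * π y * (f x * f y) = 0 := by
      rw [← zero_mul (∑ y, π y * f y), ← hf, sum_mul_sum]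
      simp only [mul_mul_mul_comm]
    simp only [wInner_mulVec, mul_sub, sub_mul, sum_sub_distrib, h0, sub_zero]
  rw [centre]
  refine sum_sum_mul_le_of_symm (fun x y => ?_) (fun x => ?_) f
  · rw [mul_sub, mul_sub, h.balance, mul_comm (π x) (π y)]
  · simp only [abs_mul, abs_of_pos (h.pos x), ← mul_sum]
    rw [mul_comm]
    refine mul_le_mul_of_nonneg_right ?_ (h.pos x).le
    have := hP x
    unfold tvDist at this
    linarith

-- `2 (I - P) - (I - P²) = (I - P)²`.
theorem dirichletForm_sq_le (h : IsReversible P π) (f : Ω → ℝ) :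
    dirichletForm (P ^ 2) π f ≤ 2 * dirichletForm P π f := by
  have h2 := two_mul_wInner_le (fun x => (h.pos x).le) f (P *ᵥ f)
  rw [dirichletForm, dirichletForm, sq, ← mulVec_mulVec, h.wInner_mulVec_comm f (P *ᵥ f)]
  linarith

theorem dirichletForm_pow_two_pow_le (h : IsReversible P π) (a : ℕ) (f : Ω → ℝ) :
    dirichletForm (P ^ 2 ^ a) π f ≤ 2 ^ a * dirichletForm P π f := by
  induction a with
  | zero => simp
  | succ a ih =>
    rw [pow_succ 2, pow_mul, pow_succ' (2 : ℝ), mul_assoc]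
    exact ((h.pow _).dirichletForm_sq_le f).trans (mul_le_mul_of_nonneg_left ih zero_le_two)

theorem poincare_of_tvDist_le (h : IsReversible P π) {ε : ℝ} (hε : ε < 1 / 2) {k : ℕ}
    (hk : k ≠ 0) (hP : ∀ x, tvDist ((P ^ k) x) π ≤ ε) :
    PoincareInequality P π (2 * k / (1 - 2 * ε)) := by
  intro f hf
  set a := Nat.log 2 k + 1
  have ha : (2 : ℝ) ^ a ≤ 2 * k := by
    rw [pow_succ']
    exact_mod_cast Nat.mul_le_mul_left 2 (Nat.pow_log_le_self 2 hk)
  have mixed (x : Ω) : tvDist ((P ^ 2 ^ a) x) π ≤ ε :=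
    (h.tvDist_antitone x (Nat.lt_pow_succ_log_self one_lt_two k).le).trans (hP x)
  have inner_le := (h.pow (2 ^ a)).wInner_mulVec_le_of_tvDist_le mixed hf
  have form_le := (h.dirichletForm_pow_two_pow_le a f).trans
    (mul_le_mul_of_nonneg_right ha (h.dirichletForm_nonneg f))
  rw [div_mul_eq_mul_div, le_div_iff₀ (by linarith)]
  rw [dirichletForm] at form_le
  linarith

theorem wInner_pow_mulVec_self_le (h : IsReversible P π) {K : ℝ} (hK : 1 ≤ K)
    (hpos : ∀ f, ⟪P *ᵥ f, P *ᵥ f⟫_[ℝ, π] ≤ ⟪f, P *ᵥ f⟫_[ℝ, π])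
    (hgap : PoincareInequality P π K) {f : Ω → ℝ} (hf : ∑ x, π x * f x = 0) (s : ℕ) :
    ⟪P ^ s *ᵥ f, P ^ s *ᵥ f⟫_[ℝ, π] ≤ (1 - 1 / K) ^ s * ⟪f, f⟫_[ℝ, π] := by
  have hK0 : 0 < K := by linarith
  have contraction {g : Ω → ℝ} (hg : ∑ x, π x * g x = 0) :
      ⟪P *ᵥ g, P *ᵥ g⟫_[ℝ, π] ≤ (1 - 1 / K) * ⟪g, g⟫_[ℝ, π] := by
    have hgK := hgap g hg
    rw [← div_le_iff₀' hK0, dirichletForm] at hgK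
    rw [one_sub_mul, one_div_mul_eq_div]
    linarith [hpos g]
  have hK1 : 0 ≤ 1 - 1 / K := by rwa [sub_nonneg, div_le_one hK0]
  induction s with
  | zero => simp
  | succ s ih =>
    rw [pow_succ', ← mulVec_mulVec, pow_succ', mul_assoc]
    refine (contraction ?_).trans (mul_le_mul_of_nonneg_left ih hK1)
    rw [(h.pow s).sum_mul_mulVec, hf]

theorem mul_mulVec_centeredDensity (h : IsReversible P π) (x y : Ω) :
    π y * (P *ᵥ centeredDensity π x) y = P x y - π y := by
  have hone : (P *ᵥ 1) y = 1 := mulVec_const h.mem_rowStochastic 1 y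
  rw [centeredDensity, mulVec_sub, Pi.sub_apply, hone, mulVec_single, Pi.smul_apply,
    MulOpposite.smul_eq_mul_unop, MulOpposite.unop_op, col_apply, mul_sub, ← mul_assoc,
    h.balance, mul_assoc, mul_comm (P x y), mul_inv_cancel_left₀ (h.pos x).ne', mul_one]

theorem sum_mul_centeredDensity (h : IsReversible P π) (x : Ω) :
    ∑ y, π y * centeredDensity π x y = 0 := by
  have hx := (h.pos x).ne'
  simp [centeredDensity, mul_sub, h.sum_eq_one, Pi.single_apply, hx]

theorem wInner_centeredDensity_self_le (h : IsReversible P π) (x : Ω) :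
    ⟪centeredDensity π x, centeredDensity π x⟫_[ℝ, π] ≤ (π x)⁻¹ := by
  have hx := (h.pos x).ne'
  have : ⟪centeredDensity π x, centeredDensity π x⟫_[ℝ, π] = centeredDensity π x x := by
    nth_rw 2 [centeredDensity]
    rw [RCLike.wInner_sub_right, wInner_eq_sum, wInner_eq_sum]
    simp only [Pi.single_apply, mul_ite, mul_zero, sum_ite_eq', mem_univ, if_true, Pi.one_apply,
      mul_one, h.sum_mul_centeredDensity, sub_zero]
    rw [mul_left_comm, mul_inv_cancel₀ hx, mul_one]
  rw [this, centeredDensity, Pi.sub_apply, Pi.single_eq_same, Pi.one_apply]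
  linarith

theorem sq_two_mul_tvDist_le (h : IsReversible P π) (x : Ω) :
    (2 * tvDist (P x) π) ^ 2
      ≤ ⟪P *ᵥ centeredDensity π x, P *ᵥ centeredDensity π x⟫_[ℝ, π] := by
  refine le_trans (le_of_eq ?_) (sq_sum_mul_abs_le (fun y => (h.pos y).le) h.sum_eq_one _)
  rw [tvDist, ← mul_assoc, mul_one_div_cancel two_ne_zero, one_mul]
  congr 1
  refine sum_congr rfl fun y _ => ?_
  rw [← h.mul_mulVec_centeredDensity, abs_mul, abs_of_pos (h.pos y)]

theorem tvDist_pow_le (h : IsReversible P π) {K : ℝ} (hK : 1 ≤ K)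
    (hpos : ∀ f, ⟪P *ᵥ f, P *ᵥ f⟫_[ℝ, π] ≤ ⟪f, P *ᵥ f⟫_[ℝ, π])
    (hgap : PoincareInequality P π K) (s : ℕ) (x : Ω) {b : ℝ} (hb : 0 ≤ b)
    (hs : (1 - 1 / K) ^ s ≤ (2 * b) ^ 2 * π x) : tvDist ((P ^ s) x) π ≤ b := by
  have hK1 : 0 ≤ 1 - 1 / K := by rwa [sub_nonneg, div_le_one (by linarith)]
  have hsq : (2 * tvDist ((P ^ s) x) π) ^ 2 ≤ (2 * b) ^ 2 :=
    calc (2 * tvDist ((P ^ s) x) π) ^ 2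
        ≤ ⟪P ^ s *ᵥ centeredDensity π x, P ^ s *ᵥ centeredDensity π x⟫_[ℝ, π] :=
          (h.pow s).sq_two_mul_tvDist_le x
      _ ≤ (1 - 1 / K) ^ s * ⟪centeredDensity π x, centeredDensity π x⟫_[ℝ, π] :=
          h.wInner_pow_mulVec_self_le hK hpos hgap (h.sum_mul_centeredDensity x) s
      _ ≤ (1 - 1 / K) ^ s * (π x)⁻¹ :=
          mul_le_mul_of_nonneg_left (h.wInner_centeredDensity_self_le x) (pow_nonneg hK1 s)
      _ ≤ (2 * b) ^ 2 := (mul_inv_le_iff₀ (h.pos x)).2 hs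
  linarith [abs_le_of_sq_le_sq' hsq (by positivity)]

end IsReversible

end ReversibleChains

section Resampling

variable {α : Type*} [DecidableEq α]

/-- The Markov operator that resamples the coordinate `e`, which becomes present with probability
`h A` when the configuration is `A`. -/
def resample (e : α) (h f : Finset α → ℝ) (A : Finset α) : ℝ :=
  h A * f (insert e A) + (1 - h A) * f (A.erase e)

/-- The discrete gradient in the coordinate `e`. -/
def grad (e : α) (f : Finset α → ℝ) (A : Finset α) : ℝ := f (insert e A) - f (A.erase e)

/-- `h` is the conditional probability, under the weight `w`, that `e` is present given the
other coordinates. The ratio condition avoids dividing by a possibly vanishing total weight. -/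
structure IsCondProb (e : α) (w h : Finset α → ℝ) : Prop where
  insert_eq : ∀ A, h (insert e A) = h A
  erase_eq : ∀ A, h (A.erase e) = h A
  ratio : ∀ A, (1 - h A) * w (insert e A) = h A * w (A.erase e)

section Commuting

variable {a b : α}

theorem resample_comm (hab : a ≠ b) (p p' : ℝ) (f : Finset α → ℝ) :
    resample a (fun _ => p) (resample b (fun _ => p') f)
      = resample b (fun _ => p') (resample a (fun _ => p) f) := by
  funext A
  simp only [resample, insert_comm b a, erase_right_comm (a := a) (b := b),
    erase_insert_of_ne hab, erase_insert_of_ne hab.symm]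
  ring

theorem grad_resample (hab : a ≠ b) (p : ℝ) (f : Finset α → ℝ) :
    grad b (resample a (fun _ => p) f) = resample a (fun _ => p) (grad b f) := by
  funext A
  simp only [resample, grad, insert_comm b a, erase_right_comm (a := a) (b := b),
    erase_insert_of_ne hab, erase_insert_of_ne hab.symm]
  ring

end Commuting

variable {e : α} {w h : Finset α → ℝ}

theorem resample_insert (H : IsCondProb e w h) (f : Finset α → ℝ) (A : Finset α) :
    resample e h f (insert e A) = resample e h f A := by
  simp only [resample, H.insert_eq, insert_idem, erase_insert_eq_erase]

theorem resample_erase (H : IsCondProb e w h) (f : Finset α → ℝ) (A : Finset α) :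
    resample e h f (A.erase e) = resample e h f A := by
  rw [resample, H.erase_eq, erase_idem, show insert e (A.erase e) = insert e A by grind, resample]

variable [Fintype α]

theorem sum_insert_add_erase (e : α) (ψ : Finset α → ℝ) :
    ∑ A, (ψ (insert e A) + ψ (A.erase e)) = 2 * ∑ A, ψ A := by
  have hinv : Function.Involutive fun A : Finset α => symmDiff A {e} :=
    symmDiff_left_involutive {e}
  have flip : ∑ A, ψ (symmDiff A {e}) = ∑ A, ψ A := Equiv.sum_comp hinv.toPerm ψ
  rw [two_mul]
  nth_rw 2 [← flip]
  rw [← sum_add_distrib]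
  refine sum_congr rfl fun A _ => ?_
  by_cases he : e ∈ A
  · have : symmDiff A {e} = A.erase e := by grind [mem_symmDiff]
    rw [this, insert_eq_of_mem he]
  · have : symmDiff A {e} = insert e A := by grind [mem_symmDiff]
    rw [this, erase_eq_of_notMem he, add_comm]

theorem sum_mul_resample (H : IsCondProb e w h) (f : Finset α → ℝ) :
    ∑ A, w A * resample e h f A = ∑ A, w A * f A := by
  have pair (A : Finset α) :
      w (insert e A) * (resample e h f (insert e A) - f (insert e A))
        + w (A.erase e) * (resample e h f (A.erase e) - f (A.erase e)) = 0 := by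
    rw [resample_insert H, resample_erase H, resample]
    linear_combination (f (A.erase e) - f (insert e A)) * H.ratio A
  have := sum_insert_add_erase e fun A => w A * (resample e h f A - f A)
  rw [sum_congr rfl fun A _ => pair A, sum_const_zero] at this
  simp only [mul_sub, sum_sub_distrib] at this
  linarith

theorem wInner_sub_wInner_resample (H : IsCondProb e w h) (f g : Finset α → ℝ) :
    ⟪f, g⟫_[ℝ, w] - ⟪f, resample e h g⟫_[ℝ, w]
      = ⟪grad e f, grad e g⟫_[ℝ, fun A => w A * (h A * (1 - h A))] := by
  rw [← RCLike.wInner_sub_right, wInner_eq_sum, ← sum_mul_resample H, wInner_eq_sum]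
  refine sum_congr rfl fun A _ => ?_
  simp only [Pi.sub_apply, mul_assoc]
  rw [resample, resample_insert H, resample_erase H, resample, grad, grad]
  ring

theorem wInner_resample_comm (H : IsCondProb e w h) (f g : Finset α → ℝ) :
    ⟪f, resample e h g⟫_[ℝ, w] = ⟪resample e h f, g⟫_[ℝ, w] := by
  have hfg := wInner_sub_wInner_resample H f g
  have hgf := wInner_sub_wInner_resample H g f
  rw [wInner_comm _ (grad e g), wInner_comm w g f, wInner_comm w g] at hgf
  linarith

theorem wInner_resample_resample (H : IsCondProb e w h) (f g : Finset α → ℝ) :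
    ⟪resample e h f, resample e h g⟫_[ℝ, w] = ⟪f, resample e h g⟫_[ℝ, w] := by
  have hgrad : grad e (resample e h g) = 0 := by
    funext A
    rw [grad, resample_insert H, resample_erase H, sub_self, Pi.zero_apply]
  have := wInner_sub_wInner_resample H f (resample e h g)
  rw [hgrad, RCLike.wInner_zero_right, sub_eq_zero] at this
  rw [← wInner_resample_comm H, ← this]

end Resampling

section Percolation

variable {V : Type*} [DecidableEq V] {G : SimpleGraph V} {p : ℝ} {e : G.edgeSet}
  {F : Finset G.edgeSet}

theorem percolationProb_nonneg (hp : 0 ≤ p) (hp1 : p ≤ 1) (F : Finset G.edgeSet)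
    (A B : Config G) : 0 ≤ percolationProb p F A B := by
  have := sub_nonneg.2 hp1
  unfold percolationProb
  split_ifs <;> positivity

theorem percolationProb_insert (he : e ∉ F) (A B : Config G) :
    percolationProb p (insert e F) A B
      = p * percolationProb p F (insert e A) B
        + (1 - p) * percolationProb p F (A.erase e) B := by
  unfold percolationProb
  by_cases hB : e ∈ B
  · have erase_ne : B \ F ≠ A.erase e \ F := fun h => by
      have : e ∈ A.erase e \ F := h ▸ mem_sdiff.2 ⟨hB, he⟩
      simp at this
    have outside : B \ insert e F = A \ insert e F ↔ B \ F = insert e A \ F := by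
      simp only [Finset.ext_iff, mem_sdiff, mem_insert]
      grind
    rw [if_neg erase_ne, mul_zero, add_zero, insert_inter_of_mem hB, insert_sdiff_of_mem _ hB,
      card_insert_of_notMem (by simp [he]), mul_ite, mul_zero, pow_succ', mul_assoc]
    simp only [outside]
  · have insert_ne : B \ F ≠ insert e A \ F := fun h => by
      have : e ∈ B \ F := h ▸ mem_sdiff.2 ⟨mem_insert_self e A, he⟩
      exact hB (mem_sdiff.1 this).1
    have outside : B \ insert e F = A \ insert e F ↔ B \ F = A.erase e \ F := by
      simp only [Finset.ext_iff, mem_sdiff, mem_insert, mem_erase]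
      grind
    rw [if_neg insert_ne, mul_zero, zero_add, insert_inter_of_notMem hB,
      insert_sdiff_of_notMem _ hB, card_insert_of_notMem (by simp [he]), mul_ite, mul_zero,
      pow_succ', mul_left_comm]
    simp only [outside]

variable [Fintype V] [DecidableRel G.Adj]

/-- The Markov operator of the percolation sub-step on the edges in `F`. -/
noncomputable def percolationOp (p : ℝ) (F : Finset G.edgeSet) (f : Config G → ℝ)
    (A : Config G) : ℝ :=
  ∑ B, percolationProb p F A B * f B

theorem percolationOp_empty (p : ℝ) (f : Config G → ℝ) : percolationOp p ∅ f = f := by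
  funext A
  simp [percolationOp, percolationProb]

theorem percolationOp_insert (he : e ∉ F) (f : Config G → ℝ) :
    percolationOp p (insert e F) f = resample e (fun _ => p) (percolationOp p F f) := by
  funext A
  simp only [percolationOp, resample, percolationProb_insert he, add_mul, sum_add_distrib,
    mul_sum, mul_assoc]

theorem sum_percolationProb (p : ℝ) (F : Finset G.edgeSet) (A : Config G) :
    ∑ B, percolationProb p F A B = 1 := by
  suffices h : percolationOp p F (fun _ => 1) = fun _ => 1 by
    simpa only [percolationOp, mul_one] using congrFun h A
  induction F using Finset.induction_on with
  | empty => rw [percolationOp_empty]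
  | insert e F he ih =>
    rw [percolationOp_insert he, ih]
    funext A
    rw [resample, mul_one, mul_one, add_sub_cancel]

theorem resample_percolationOp (he : e ∉ F) (f : Config G → ℝ) :
    resample e (fun _ => p) (percolationOp p F f)
      = percolationOp p F (resample e (fun _ => p) f) := by
  induction F using Finset.induction_on with
  | empty => simp only [percolationOp_empty]
  | insert a F ha ih =>
    rw [mem_insert, not_or] at he
    rw [percolationOp_insert ha, percolationOp_insert ha, resample_comm he.1, ih he.2]

theorem grad_percolationOp (he : e ∉ F) (f : Config G → ℝ) :
    grad e (percolationOp p F f) = percolationOp p F (grad e f) := by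
  induction F using Finset.induction_on with
  | empty => simp only [percolationOp_empty]
  | insert a F ha ih =>
    rw [mem_insert, not_or] at he
    rw [percolationOp_insert ha, percolationOp_insert ha, grad_resample (Ne.symm he.1), ih he.2]

variable {w : Config G → ℝ}

theorem wInner_percolationOp_comm (H : ∀ e ∈ F, IsCondProb e w fun _ => p) (f g : Config G → ℝ) :
    ⟪f, percolationOp p F g⟫_[ℝ, w] = ⟪percolationOp p F f, g⟫_[ℝ, w] := by
  induction F using Finset.induction_on generalizing f g with
  | empty => simp only [percolationOp_empty]
  | insert e F he ih =>
    rw [percolationOp_insert he, percolationOp_insert he,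
      wInner_resample_comm (H e (mem_insert_self e F)),
      ih (fun a ha => H a (mem_insert_of_mem ha)), resample_percolationOp he]

theorem wInner_percolationOp_self_le (hp : 0 ≤ p) (hp1 : p ≤ 1) (hw : ∀ A, 0 ≤ w A)
    (H : ∀ e ∈ F, IsCondProb e w fun _ => p) (f : Config G → ℝ) :
    ⟪percolationOp p F f, percolationOp p F f⟫_[ℝ, w] ≤ ⟪f, f⟫_[ℝ, w] := by
  induction F using Finset.induction_on with
  | empty => simp only [percolationOp_empty, le_refl]
  | insert e F he ih =>
    have He := H e (mem_insert_self e F)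
    refine le_trans ?_ (ih fun a ha => H a (mem_insert_of_mem ha))
    rw [percolationOp_insert he, wInner_resample_resample He, ← sub_nonneg,
      wInner_sub_wInner_resample He]
    exact wInner_self_nonneg
      (fun A => mul_nonneg (hw A) (mul_nonneg hp (sub_nonneg.2 hp1))) _

-- The Efron–Stein inequality.
theorem wInner_sub_wInner_percolationOp_le (hp : 0 ≤ p) (hp1 : p ≤ 1) (hw : ∀ A, 0 ≤ w A)
    (H : ∀ e ∈ F, IsCondProb e w fun _ => p) (f : Config G → ℝ) :
    ⟪f, f⟫_[ℝ, w] - ⟪f, percolationOp p F f⟫_[ℝ, w]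
      ≤ ∑ e ∈ F, ⟪grad e f, grad e f⟫_[ℝ, fun A => w A * (p * (1 - p))] := by
  induction F using Finset.induction_on with
  | empty => simp only [percolationOp_empty, sub_self, sum_empty, le_refl]
  | insert e F he ih =>
    have HF := fun a ha => H a (mem_insert_of_mem ha)
    set w' : Config G → ℝ := fun A => w A * (p * (1 - p))
    have hw' (A : Config G) : 0 ≤ w' A := mul_nonneg (hw A) (mul_nonneg hp (sub_nonneg.2 hp1))
    have H' (a : G.edgeSet) (ha : a ∈ F) : IsCondProb a w' fun _ => p :=
      ⟨fun _ => rfl, fun _ => rfl, fun A => by simp only [w', ← mul_assoc, (HF a ha).ratio A]⟩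
    have step := wInner_sub_wInner_resample (H e (mem_insert_self e F)) f (percolationOp p F f)
    rw [grad_percolationOp he] at step
    have contraction := wInner_percolationOp_self_le hp hp1 hw' H' (grad e f)
    have cauchy := two_mul_wInner_le hw' (grad e f) (percolationOp p F (grad e f))
    rw [sum_insert he, percolationOp_insert he]
    linarith [ih HF]

end Percolation

section Components

variable {V : Type*} {H H' : SimpleGraph V}

theorem reachable_of_reachable_sup_edge {u v x y : V}
    (h : (H ⊔ SimpleGraph.edge u v).Reachable x y) :
    H.Reachable x y ∨
      (H.Reachable u x ∨ H.Reachable v x) ∧ (H.Reachable u y ∨ H.Reachable v y) := by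
  obtain ⟨walk⟩ := h
  induction walk with
  | nil => exact Or.inl (SimpleGraph.Reachable.refl _)
  | @cons x z y hadj _ ih =>
    rcases hadj with hadj | hadj
    · rcases ih with hzy | ⟨hz, hy⟩
      · exact Or.inl (hadj.reachable.trans hzy)
      · exact Or.inr ⟨hz.imp (·.trans hadj.symm.reachable) (·.trans hadj.symm.reachable), hy⟩
    · right
      rcases ((SimpleGraph.edge_adj ..).1 hadj).1 with ⟨rfl, rfl⟩ | ⟨rfl, rfl⟩
      · exact ⟨Or.inl (SimpleGraph.Reachable.refl _), ih.elim Or.inr And.right⟩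
      · exact ⟨Or.inr (SimpleGraph.Reachable.refl _), ih.elim Or.inl And.right⟩

variable [Finite V]

theorem card_connectedComponent_anti (hle : H ≤ H') :
    Nat.card H'.ConnectedComponent ≤ Nat.card H.ConnectedComponent :=
  Nat.card_le_card_of_surjective _ (SimpleGraph.ConnectedComponent.surjective_map_ofLE hle)

-- Only the components of `u` and `v` can merge, so outside the component of `u` the map between
-- the sets of components is injective.
theorem card_connectedComponent_le_card_sup_edge_add_one (H : SimpleGraph V) (u v : V) :
    Nat.card H.ConnectedComponent
      ≤ Nat.card (H ⊔ SimpleGraph.edge u v).ConnectedComponent + 1 := by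
  classical
  rw [← Finite.card_option]
  refine Nat.card_le_card_of_injective (fun c => if c = H.connectedComponentMk u then none
    else some (c.map (SimpleGraph.Hom.ofLE le_sup_left))) fun c d hcd => ?_
  induction c using SimpleGraph.ConnectedComponent.ind with | h x
  induction d using SimpleGraph.ConnectedComponent.ind with | h y
  dsimp only at hcd
  split_ifs at hcd with hx hy hy
  · rw [hx, hy]
  · rw [Option.some_inj, SimpleGraph.ConnectedComponent.map_mk,
      SimpleGraph.ConnectedComponent.map_mk, SimpleGraph.ConnectedComponent.eq] at hcd
    rw [SimpleGraph.ConnectedComponent.eq] at hx hy ⊢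
    rcases reachable_of_reachable_sup_edge hcd with hxy | ⟨hx', hy'⟩
    · exact hxy
    · exact (hx'.resolve_left fun h => hx h.symm).symm.trans
        (hy'.resolve_left fun h => hy h.symm)

end Components

section Configurations

variable {V : Type*} {G : SimpleGraph V}

theorem Config.graph_adj {A : Config G} {x y : V} :
    A.graph.Adj x y ↔ ∃ h : s(x, y) ∈ G.edgeSet, (⟨s(x, y), h⟩ : G.edgeSet) ∈ A := by
  rw [Config.graph, SimpleGraph.fromEdgeSet_adj, Set.mem_ofPred_eq, and_iff_left_iff_imp]
  rintro ⟨h, -⟩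
  exact G.ne_of_adj h

theorem Config.numComponents_le_card [Fintype V] (A : Config G) :
    A.numComponents ≤ Fintype.card V := by
  rw [← Nat.card_eq_fintype_card]
  exact Nat.card_le_card_of_surjective A.graph.connectedComponentMk Quot.mk_surjective

variable [DecidableEq V] {A : Config G} {e : G.edgeSet}

theorem Config.graph_insert_adj {x y : V} :
    (Config.graph (insert e A)).Adj x y ↔ s(x, y) = e ∨ A.graph.Adj x y := by
  simp only [Config.graph_adj, mem_insert, Subtype.ext_iff]
  constructor
  · rintro ⟨h, hxy | hxy⟩
    exacts [Or.inl hxy, Or.inr ⟨h, hxy⟩]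
  · rintro (hxy | ⟨h, hxy⟩)
    exacts [⟨hxy ▸ e.2, Or.inl hxy⟩, ⟨h, Or.inr hxy⟩]

theorem Config.graph_le_insert (A : Config G) (e : G.edgeSet) :
    A.graph ≤ Config.graph (insert e A) :=
  fun _ _ h => Config.graph_insert_adj.2 (Or.inr h)

theorem Config.graph_insert {u v : V} (he : (e : Sym2 V) = s(u, v)) :
    Config.graph (insert e A) = A.graph ⊔ SimpleGraph.edge u v := by
  ext x y
  rw [Config.graph_insert_adj, SimpleGraph.sup_adj, or_comm, he, SimpleGraph.edge_adj,
    ← Sym2.eq_iff, iff_comm, or_congr_right]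
  exact and_iff_left_of_imp fun h => G.ne_of_adj (G.mem_edgeSet.1 (h ▸ he ▸ e.2))

variable [Finite V]

theorem Config.numComponents_insert_le (A : Config G) (e : G.edgeSet) :
    Config.numComponents (insert e A) ≤ A.numComponents :=
  card_connectedComponent_anti (A.graph_le_insert e)

theorem Config.numComponents_le_insert_add_one (A : Config G) (e : G.edgeSet) :
    A.numComponents ≤ Config.numComponents (insert e A) + 1 := by
  obtain ⟨⟨u, v⟩, he⟩ := (e : Sym2 V).mk_surjective
  rw [Config.numComponents, Config.numComponents, Config.graph_insert he.symm]
  exact card_connectedComponent_le_card_sup_edge_add_one _ u v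

end Configurations

section Gibbs

variable {V : Type*} {G : SimpleGraph V} [Fintype V] [DecidableRel G.Adj] {p q : ℝ}

theorem weight_pos (hp : 0 < p) (hp1 : p < 1) (hq : 0 < q) (A : Config G) :
    0 < weight G p q A := by
  have := sub_pos.2 hp1
  unfold weight
  positivity

theorem partitionFunction_pos (hp : 0 < p) (hp1 : p < 1) (hq : 0 < q) :
    0 < partitionFunction G p q :=
  sum_pos (fun A _ => weight_pos hp hp1 hq A) univ_nonempty

theorem gibbs_pos (hp : 0 < p) (hp1 : p < 1) (hq : 0 < q) (A : Config G) : 0 < gibbs G p q A :=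
  div_pos (weight_pos hp hp1 hq A) (partitionFunction_pos hp hp1 hq)

theorem sum_gibbs (hp : 0 < p) (hp1 : p < 1) (hq : 0 < q) : ∑ A, gibbs G p q A = 1 := by
  unfold gibbs
  rw [← sum_div]
  exact div_self (partitionFunction_pos hp hp1 hq).ne'

theorem partitionFunction_le (hp : 0 ≤ p) (hp1 : p ≤ 1) (hq : 1 ≤ q) :
    partitionFunction G p q ≤ q ^ Fintype.card V := by
  have := sub_nonneg.2 hp1
  have percolation_total := Fintype.sum_pow_mul_eq_add_pow G.edgeSet p (1 - p)
  rw [add_sub_cancel, one_pow] at percolation_total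
  calc partitionFunction G p q
      ≤ ∑ A : Config G, p ^ A.card * (1 - p) ^ (Fintype.card G.edgeSet - A.card)
          * q ^ Fintype.card V :=
        sum_le_sum fun A _ => mul_le_mul_of_nonneg_left
          (pow_le_pow_right₀ hq A.numComponents_le_card) (by positivity)
    _ = q ^ Fintype.card V := by rw [← sum_mul, percolation_total, one_mul]

theorem le_gibbs (hp : 0 < p) (hp1 : p < 1) (hq : 1 ≤ q) (A : Config G) :
    p ^ A.card * (1 - p) ^ Fintype.card G.edgeSet / q ^ Fintype.card V ≤ gibbs G p q A := by
  have hp1' := sub_pos.2 hp1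
  have hq0 := zero_lt_one.trans_le hq
  have drop_pow : (1 - p) ^ Fintype.card G.edgeSet ≤ (1 - p) ^ (Fintype.card G.edgeSet - A.card) :=
    pow_le_pow_of_le_one hp1'.le (by linarith) (Nat.sub_le _ _)
  refine div_le_div₀ (weight_pos hp hp1 hq0 A).le ?_ (partitionFunction_pos hp hp1 hq0)
    (partitionFunction_le hp.le hp1.le hq)
  calc p ^ A.card * (1 - p) ^ Fintype.card G.edgeSet
      ≤ p ^ A.card * (1 - p) ^ (Fintype.card G.edgeSet - A.card) := by gcongr
    _ ≤ weight G p q A := le_mul_of_one_le_right (by positivity) (one_le_pow₀ hq)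

variable [DecidableEq V]

theorem weight_insert {A : Config G} {e : G.edgeSet} (he : e ∉ A) :
    (1 - p) * q ^ A.numComponents * weight G p q (insert e A)
      = p * q ^ Config.numComponents (insert e A) * weight G p q A := by
  have hm : (insert e A).card ≤ Fintype.card G.edgeSet := card_le_univ _
  rw [card_insert_of_notMem he] at hm
  rw [weight, weight, card_insert_of_notMem he, pow_succ,
    show Fintype.card G.edgeSet - A.card = Fintype.card G.edgeSet - (A.card + 1) + 1 by omega,
    pow_succ]
  ring

theorem gibbs_insert {A : Config G} {e : G.edgeSet} (he : e ∉ A) :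
    (1 - p) * q ^ A.numComponents * gibbs G p q (insert e A)
      = p * q ^ Config.numComponents (insert e A) * gibbs G p q A := by
  rw [gibbs, gibbs, ← mul_div_assoc, ← mul_div_assoc, weight_insert he]

end Gibbs

section Glauber

variable {V : Type*} {G : SimpleGraph V} [Fintype V] [DecidableEq V] [DecidableRel G.Adj] {p q : ℝ}

theorem isCondProb_heatBathProb (hp : 0 < p) (hp1 : p < 1) (hq : 0 < q) (e : G.edgeSet) :
    IsCondProb e (gibbs G p q) (heatBathProb G p q · e) where
  insert_eq A := by rw [heatBathProb, insert_idem, erase_insert_eq_erase, heatBathProb]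
  erase_eq A := by
    rw [heatBathProb, erase_idem, show insert e (A.erase e) = insert e A by grind, heatBathProb]
  ratio A := by
    have hpos := add_pos (gibbs_pos hp hp1 hq (insert e A)) (gibbs_pos hp hp1 hq (A.erase e))
    rw [heatBathProb, one_sub_div hpos.ne', add_sub_cancel_left, div_mul_eq_mul_div,
      div_mul_eq_mul_div, mul_comm]

theorem heatBathProb_eq_or (hp : 0 < p) (hp1 : p < 1) (hq : 0 < q) (A : Config G)
    (e : G.edgeSet) :
    heatBathProb G p q A e = p ∨ heatBathProb G p q A e = p / (p + (1 - p) * q) := by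
  have := sub_pos.2 hp1
  have ratio := gibbs_insert (p := p) (q := q) (notMem_erase e A)
  have hins : insert e (A.erase e) = insert e A := by grind
  have at_most_one_more := Config.numComponents_le_insert_add_one (A.erase e) e
  have no_fewer := Config.numComponents_insert_le (A.erase e) e
  rw [hins] at ratio at_most_one_more no_fewer
  have hpos := add_pos (gibbs_pos hp hp1 hq (insert e A)) (gibbs_pos hp hp1 hq (A.erase e))
  have hqc := pow_ne_zero (Config.numComponents (insert e A)) hq.ne'
  rw [heatBathProb, div_eq_iff hpos.ne', div_eq_div_iff hpos.ne' (by positivity)]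
  rcases no_fewer.eq_or_lt with hc | hc
  · left
    rw [← hc, mul_right_comm, mul_right_comm p] at ratio
    linear_combination mul_right_cancel₀ hqc ratio
  · right
    rw [le_antisymm at_most_one_more hc, pow_succ', ← mul_assoc, mul_right_comm,
      mul_right_comm p] at ratio
    linear_combination mul_right_cancel₀ hqc ratio

theorem heatBathProb_nonneg (hp : 0 < p) (hp1 : p < 1) (hq : 0 < q) (A : Config G)
    (e : G.edgeSet) : 0 ≤ heatBathProb G p q A e :=
  div_nonneg (gibbs_pos hp hp1 hq _).le
    (add_pos (gibbs_pos hp hp1 hq _) (gibbs_pos hp hp1 hq _)).le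

theorem heatBathProb_le (hp : 0 < p) (hp1 : p < 1) (hq : 1 ≤ q) (A : Config G) (e : G.edgeSet) :
    heatBathProb G p q A e ≤ p := by
  rcases heatBathProb_eq_or hp hp1 (zero_lt_one.trans_le hq) A e with h | h <;> rw [h]
  exact div_le_self hp.le (by nlinarith)

theorem mul_one_sub_le_heatBathProb (hp : 0 < p) (hp1 : p < 1) (hq : 1 ≤ q) (A : Config G)
    (e : G.edgeSet) :
    p * (1 - p) ≤ q * (heatBathProb G p q A e * (1 - heatBathProb G p q A e)) := by
  have hq0 := zero_lt_one.trans_le hq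
  have hvar : 0 < p * (1 - p) := mul_pos hp (sub_pos.2 hp1)
  rcases heatBathProb_eq_or hp hp1 hq0 A e with h | h <;> rw [h]
  · exact le_mul_of_one_le_left hvar.le hq
  · have hd : 0 < p + (1 - p) * q := add_pos hp (mul_pos (sub_pos.2 hp1) hq0)
    have hdq : p + (1 - p) * q ≤ q := by nlinarith
    calc p * (1 - p) ≤ p * (1 - p) * (q ^ 2 / (p + (1 - p) * q) ^ 2) := by
          refine le_mul_of_one_le_right hvar.le ?_
          rw [one_le_div (by positivity)]
          gcongr
      _ = q * (p / (p + (1 - p) * q) * (1 - p / (p + (1 - p) * q))) := by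
          field_simp
          ring

theorem glauber_mulVec (f : Config G → ℝ) (A : Config G) :
    (glauber G p q *ᵥ f) A = 𝔼 e, resample e (heatBathProb G p q · e) f A := by
  simp only [mulVec, dotProduct, glauber, sum_mul]
  rw [sum_comm, Fintype.expect_eq_sum_div_card, sum_div]
  refine sum_congr rfl fun e _ => ?_
  simp only [mul_assoc, ← mul_sum, add_mul, sum_add_distrib, ite_mul, zero_mul, sum_ite_eq',
    mem_univ, if_true]
  rw [one_div_mul_eq_div, resample]

theorem wInner_glauber (w f g : Config G → ℝ) :
    ⟪f, glauber G p q *ᵥ g⟫_[ℝ, w] = 𝔼 e, ⟪f, resample e (heatBathProb G p q · e) g⟫_[ℝ, w] := by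
  simp only [wInner_eq_sum, glauber_mulVec, mul_expect]
  exact (expect_sum_comm ..).symm

theorem dirichletForm_glauber [Nonempty G.edgeSet] (hp : 0 < p) (hp1 : p < 1) (hq : 0 < q)
    (f : Config G → ℝ) :
    dirichletForm (glauber G p q) (gibbs G p q) f = 𝔼 e, ⟪grad e f, grad e f⟫_[ℝ, fun A =>
      gibbs G p q A * (heatBathProb G p q A e * (1 - heatBathProb G p q A e))] := by
  rw [dirichletForm, wInner_glauber, ← Fintype.expect_const (ι := G.edgeSet) ⟪f, f⟫_[ℝ, _],
    ← expect_sub_distrib]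
  exact expect_congr rfl fun e _ =>
    wInner_sub_wInner_resample (isCondProb_heatBathProb hp hp1 hq e) f f

-- The Glauber dynamics is an average of projections.
theorem wInner_glauber_self_le (hp : 0 < p) (hp1 : p < 1) (hq : 0 < q) (f : Config G → ℝ) :
    ⟪glauber G p q *ᵥ f, glauber G p q *ᵥ f⟫_[ℝ, gibbs G p q]
      ≤ ⟪f, glauber G p q *ᵥ f⟫_[ℝ, gibbs G p q] := by
  set u : G.edgeSet → Config G → ℝ := fun e => resample e (heatBathProb G p q · e) f
  have jensen (A : Config G) :
      (glauber G p q *ᵥ f) A * (glauber G p q *ᵥ f) A ≤ 𝔼 e, u e A * u e A := by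
    simp only [glauber_mulVec, Fintype.expect_eq_sum_div_card, ← sq]
    exact sum_div_card_sq_le_sum_sq_div_card ..
  calc ⟪glauber G p q *ᵥ f, glauber G p q *ᵥ f⟫_[ℝ, gibbs G p q]
      ≤ ∑ A, gibbs G p q A * 𝔼 e, u e A * u e A := by
        rw [wInner_eq_sum]
        exact sum_le_sum fun A _ => mul_le_mul_of_nonneg_left (jensen A) (gibbs_pos hp hp1 hq A).le
    _ = 𝔼 e, ⟪u e, u e⟫_[ℝ, gibbs G p q] := by
        simp only [wInner_eq_sum, mul_expect]
        exact (expect_sum_comm ..).symm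
    _ = ⟪f, glauber G p q *ᵥ f⟫_[ℝ, gibbs G p q] := by
        rw [wInner_glauber]
        exact expect_congr rfl fun e _ =>
          wInner_resample_resample (isCondProb_heatBathProb hp hp1 hq e) f f

variable [Nonempty G.edgeSet]

theorem glauber_mem_rowStochastic (hp : 0 < p) (hp1 : p < 1) (hq : 1 ≤ q) :
    glauber G p q ∈ rowStochastic ℝ (Config G) := by
  refine mem_rowStochastic_iff_sum.2 ⟨fun A B => ?_, fun A => ?_⟩
  · refine sum_nonneg fun e _ => mul_nonneg (by positivity) ?_
    have hnonneg := heatBathProb_nonneg hp hp1 (zero_lt_one.trans_le hq) A e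
    have hle := heatBathProb_le hp hp1 hq A e
    split_ifs <;> linarith
  · have h := glauber_mulVec (p := p) (q := q) (fun _ => 1) A
    simpa only [mulVec, dotProduct, resample, mul_one, add_sub_cancel, Fintype.expect_const]
      using h

theorem glauber_isReversible (hp : 0 < p) (hp1 : p < 1) (hq : 1 ≤ q) :
    IsReversible (glauber G p q) (gibbs G p q) where
  mem_rowStochastic := glauber_mem_rowStochastic hp hp1 hq
  pos := gibbs_pos hp hp1 (zero_lt_one.trans_le hq)
  sum_eq_one := sum_gibbs hp hp1 (zero_lt_one.trans_le hq)
  balance := balance_of_wInner_mulVec_comm fun f g => by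
    rw [wInner_comm _ _ g, wInner_glauber, wInner_glauber]
    refine expect_congr rfl fun e _ => ?_
    rw [wInner_resample_comm (isCondProb_heatBathProb hp hp1 (zero_lt_one.trans_le hq) e),
      wInner_comm]

theorem glauber_mulVec_card_le (hp : 0 < p) (hp1 : p < 1) (hq : 1 ≤ q) (A : Config G) :
    (glauber G p q *ᵥ fun B => (B.card : ℝ) - p * Fintype.card G.edgeSet) A
      ≤ (1 - 1 / (Fintype.card G.edgeSet : ℝ)) * (A.card - p * Fintype.card G.edgeSet) := by
  set m := (Fintype.card G.edgeSet : ℝ)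
  have hm0 : 0 < m := Nat.cast_pos.2 Fintype.card_pos
  have resample_le (e : G.edgeSet) :
      resample e (heatBathProb G p q · e) (fun B => (B.card : ℝ) - p * m) A
        ≤ A.card - p * m + p - (if e ∈ A then 1 else 0) := by
    have hle := heatBathProb_le hp hp1 hq A e
    have herase : ((A.erase e).card : ℝ) = A.card - (if e ∈ A then 1 else 0) := by
      split_ifs with he
      · rw [← card_erase_add_one he, Nat.cast_succ, add_sub_cancel_right]
      · rw [erase_eq_of_notMem he, sub_zero]
    have hinsert : ((insert e A).card : ℝ) = (A.erase e).card + 1 := by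
      rw [← Nat.cast_add_one, ← card_insert_of_notMem (notMem_erase e A)]
      congr 2
      grind
    rw [resample, hinsert, herase]
    linarith
  calc (glauber G p q *ᵥ fun B => (B.card : ℝ) - p * m) A
      ≤ 𝔼 e : G.edgeSet, (A.card - p * m + p - (if e ∈ A then 1 else 0)) := by
        rw [glauber_mulVec]
        exact expect_le_expect fun e _ => resample_le e
    _ = A.card - p * m + p - A.card / m := by
        rw [expect_sub_distrib, Fintype.expect_const, Fintype.expect_eq_sum_div_card, sum_boole,
          filter_mem_eq_inter, univ_inter]
    _ = (1 - 1 / m) * (A.card - p * m) := by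
        field_simp
        ring

end Glauber

section Activation

variable {V : Type*} {G : SimpleGraph V}

/-- `U` is a union of vertex sets of connected components of `(V, A)`. -/
def IsUnionOfComponents (A : Config G) (U : Finset V) : Prop :=
  ∀ x y, A.graph.Adj x y → x ∈ U → y ∈ U

theorem IsUnionOfComponents.mem_of_reachable {A : Config G} {U : Finset V}
    (h : IsUnionOfComponents A U) {x y : V} (hxy : A.graph.Reachable x y) (hx : x ∈ U) :
    y ∈ U := by
  obtain ⟨walk⟩ := hxy
  induction walk with
  | nil => exact hx
  | cons hadj _ ih => exact ih (h _ _ hadj hx)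

/-- The edges of `G` with both endpoints in `U`: those the percolation sub-step resamples when `U`
is the set of active vertices. -/
def edgesInside [Fintype V] [DecidableEq V] [DecidableRel G.Adj] (U : Finset V) :
    Finset G.edgeSet :=
  univ.filter fun e => ∀ v ∈ (e : Sym2 V), v ∈ U

open Classical in
/-- The number of connected components of `(V, A)` that meet `U`. -/
noncomputable def numComponentsMeeting (A : Config G) (U : Finset V) : ℕ :=
  (U.image A.graph.connectedComponentMk).card

variable [Fintype V]

open Classical in
/-- The active vertices, when `S` is the set of activated components of `(V, A)`. -/
noncomputable def activeVertices (A : Config G) (S : Finset A.graph.ConnectedComponent) :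
    Finset V :=
  univ.filter fun v => A.graph.connectedComponentMk v ∈ S

theorem mem_activeVertices {A : Config G} {S : Finset A.graph.ConnectedComponent} {v : V} :
    v ∈ activeVertices A S ↔ A.graph.connectedComponentMk v ∈ S := by
  simp only [activeVertices, mem_filter_univ]

open Classical in
theorem image_activeVertices (A : Config G) (S : Finset A.graph.ConnectedComponent) :
    (activeVertices A S).image A.graph.connectedComponentMk = S := by
  ext c
  induction c using SimpleGraph.ConnectedComponent.ind with | h v
  simp only [mem_image, mem_activeVertices]
  exact ⟨fun ⟨_, hx, hxv⟩ => hxv ▸ hx, fun hv => ⟨v, hv, rfl⟩⟩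

theorem isUnionOfComponents_activeVertices (A : Config G)
    (S : Finset A.graph.ConnectedComponent) : IsUnionOfComponents A (activeVertices A S) := by
  intro x y hxy hx
  rw [mem_activeVertices] at hx ⊢
  rwa [← SimpleGraph.ConnectedComponent.sound hxy.reachable]

open Classical in
theorem IsUnionOfComponents.activeVertices_image {A : Config G} {U : Finset V}
    (h : IsUnionOfComponents A U) :
    activeVertices A (U.image A.graph.connectedComponentMk) = U := by
  ext v
  simp only [mem_activeVertices, mem_image, SimpleGraph.ConnectedComponent.eq]
  exact ⟨fun ⟨x, hx, hxv⟩ => h.mem_of_reachable hxv hx, fun hv => ⟨v, hv, .refl v⟩⟩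

variable [DecidableEq V]

open Classical in
/-- The probability that `U` is the set of active vertices in a Chayes-Machta step from `A`. -/
noncomputable def activationProb (q : ℝ) (A : Config G) (U : Finset V) : ℝ :=
  if IsUnionOfComponents A U then
    (1 / q) ^ numComponentsMeeting A U * (1 - 1 / q) ^ numComponentsMeeting A Uᶜ else 0

theorem activationProb_nonneg {q : ℝ} (hq : 1 ≤ q) (A : Config G) (U : Finset V) :
    0 ≤ activationProb q A U := by
  have inactive_nonneg : 0 ≤ 1 - 1 / q := sub_nonneg.2 (div_le_one_of_le₀ hq (by linarith))
  unfold activationProb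
  split_ifs <;> positivity

theorem IsUnionOfComponents.numComponents_eq {A : Config G} {U : Finset V}
    (h : IsUnionOfComponents A U) :
    A.numComponents = numComponentsMeeting A U + numComponentsMeeting A Uᶜ := by
  classical
  rw [numComponentsMeeting, numComponentsMeeting, ← card_union_of_disjoint, ← image_union,
    union_compl, Config.numComponents, Nat.card_eq_fintype_card, ← card_univ,
    image_univ_of_surjective (f := A.graph.connectedComponentMk) Quot.mk_surjective]
  rw [disjoint_left]
  intro c hc hc'
  obtain ⟨x, hx, rfl⟩ := mem_image.1 hc
  obtain ⟨y, hy, hxy⟩ := mem_image.1 hc'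
  exact mem_compl.1 hy (h.mem_of_reachable (SimpleGraph.ConnectedComponent.eq.1 hxy.symm) hx)

-- Multiplying by `q ^ c(A)` removes all dependence on the configuration inside `U`.
theorem IsUnionOfComponents.activationProb_mul_pow {q : ℝ} (hq : q ≠ 0) {A : Config G}
    {U : Finset V} (h : IsUnionOfComponents A U) :
    activationProb q A U * q ^ A.numComponents = (q - 1) ^ numComponentsMeeting A Uᶜ := by
  rw [activationProb, if_pos h, h.numComponents_eq, pow_add, mul_mul_mul_comm, ← mul_pow,
    ← mul_pow, one_div_mul_cancel hq, one_pow, one_mul, sub_mul, one_mul, one_div_mul_cancel hq]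

open Classical in
theorem activationProb_activeVertices (q : ℝ) (A : Config G)
    (S : Finset A.graph.ConnectedComponent) :
    activationProb q A (activeVertices A S) = (1 / q) ^ S.card * (1 - 1 / q) ^ Sᶜ.card := by
  have hcompl : (activeVertices A S)ᶜ = activeVertices A Sᶜ := by
    ext v
    simp only [mem_compl, mem_activeVertices]
  rw [activationProb, if_pos (isUnionOfComponents_activeVertices A S), hcompl,
    numComponentsMeeting, numComponentsMeeting, image_activeVertices, image_activeVertices]

open Classical in
theorem sum_activation (q : ℝ) (A : Config G) (φ : Finset V → ℝ) :
    ∑ S : Finset A.graph.ConnectedComponent,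
      (1 / q) ^ S.card * (1 - 1 / q) ^ Sᶜ.card * φ (activeVertices A S)
      = ∑ U, activationProb q A U * φ U := by
  refine sum_of_injOn (activeVertices A)
    (Function.LeftInverse.injective (image_activeVertices A)).injOn (fun _ _ => mem_univ _)
    (fun U _ hU => ?_) fun S _ => ?_
  · have not_union : ¬IsUnionOfComponents A U := fun h => hU ⟨_, mem_univ _, h.activeVertices_image⟩
    rw [activationProb, if_neg not_union, zero_mul]
  · rw [activationProb_activeVertices]

theorem sum_activationProb (q : ℝ) (A : Config G) : ∑ U, activationProb q A U = 1 := by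
  classical
  have h := sum_activation q A fun _ => 1
  simp only [mul_one] at h
  have total := Fintype.sum_pow_mul_eq_add_pow A.graph.ConnectedComponent (1 / q) (1 - 1 / q)
  rw [add_sub_cancel, one_pow] at total
  rw [← h]
  simpa only [card_compl] using total

variable [DecidableRel G.Adj]

theorem edgesInside_activeVertices (A : Config G) (S : Finset A.graph.ConnectedComponent) :
    edgesInside (activeVertices A S) = activeEdges A S := by
  ext e
  simp only [edgesInside, activeEdges, mem_filter_univ, mem_activeVertices]

section Insert

variable {A : Config G} {U : Finset V} {e : G.edgeSet}

theorem adj_of_insert_adj (he : e ∈ edgesInside U) {x y : V}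
    (h : (Config.graph (insert e A)).Adj x y) (hx : x ∉ U) : A.graph.Adj x y :=
  (Config.graph_insert_adj.1 h).resolve_left fun hxy =>
    hx ((mem_filter_univ _).1 he x (hxy ▸ Sym2.mem_mk_left x y))

theorem isUnionOfComponents_insert_iff (he : e ∈ edgesInside U) :
    IsUnionOfComponents (insert e A) U ↔ IsUnionOfComponents A U := by
  refine ⟨fun h x y hxy => h x y (A.graph_le_insert e hxy), fun h x y hxy hx => ?_⟩
  by_contra hy
  exact hy (h x y (adj_of_insert_adj he hxy.symm hy).symm hx)

theorem IsUnionOfComponents.reachable_of_insert (h : IsUnionOfComponents A U)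
    (he : e ∈ edgesInside U) {x y : V} (hxy : (Config.graph (insert e A)).Reachable x y)
    (hx : x ∉ U) : A.graph.Reachable x y := by
  obtain ⟨walk⟩ := hxy
  induction walk with
  | nil => exact .refl _
  | cons hadj _ ih =>
    have hadj' := adj_of_insert_adj he hadj hx
    exact hadj'.reachable.trans (ih fun hz => hx (h _ _ hadj'.symm hz))

theorem IsUnionOfComponents.numComponentsMeeting_compl_insert (h : IsUnionOfComponents A U)
    (he : e ∈ edgesInside U) :
    numComponentsMeeting (insert e A) Uᶜ = numComponentsMeeting A Uᶜ := by
  classical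
  have merge : Uᶜ.image (Config.graph (insert e A)).connectedComponentMk
      = (Uᶜ.image A.graph.connectedComponentMk).image
          (·.map (SimpleGraph.Hom.ofLE (A.graph_le_insert e))) := by
    rw [image_image]
    rfl
  rw [numComponentsMeeting, merge, card_image_of_injOn, numComponentsMeeting]
  rintro c hc d hd hcd
  obtain ⟨x, hx, rfl⟩ := mem_image.1 hc
  obtain ⟨y, -, rfl⟩ := mem_image.1 hd
  exact SimpleGraph.ConnectedComponent.sound
    (h.reachable_of_insert he (SimpleGraph.ConnectedComponent.exact hcd) (mem_compl.1 hx))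

end Insert

variable {p q : ℝ}

-- Given the active set `U`, the edges inside `U` are independent Bernoulli variables.
theorem isCondProb_activation (hq : 0 < q) {U : Finset V} {e : G.edgeSet}
    (he : e ∈ edgesInside U) :
    IsCondProb e (fun A => gibbs G p q A * activationProb q A U) (fun _ => p) where
  insert_eq _ := rfl
  erase_eq _ := rfl
  ratio A := by
    have hins : insert e (A.erase e) = insert e A := by grind
    have union_iff := isUnionOfComponents_insert_iff (A := A.erase e) he
    have ratio := gibbs_insert (p := p) (q := q) (notMem_erase e A)
    rw [hins] at union_iff ratio
    by_cases hU : IsUnionOfComponents (A.erase e) U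
    · have hinsert := (union_iff.2 hU).activationProb_mul_pow hq.ne'
      have herase := hU.activationProb_mul_pow hq.ne'
      have hcompl := hU.numComponentsMeeting_compl_insert he
      rw [hins] at hcompl
      rw [hcompl, ← herase] at hinsert
      have hpos := pow_pos hq (Config.numComponents (insert e A))
      refine mul_right_cancel₀ hpos.ne' ?_
      linear_combination (1 - p) * gibbs G p q (insert e A) * hinsert
        + activationProb q (A.erase e) U * ratio
    · have hU' := mt union_iff.1 hU
      rw [activationProb, activationProb, if_neg hU, if_neg hU']
      ring

end Activation

section ChayesMachta

variable {V : Type*} {G : SimpleGraph V} [Fintype V] [DecidableEq V] [DecidableRel G.Adj] {p q : ℝ}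

theorem chayesMachta_apply (A B : Config G) : chayesMachta G p q A B
    = ∑ U, activationProb q A U * percolationProb p (edgesInside U) A B := by
  rw [← sum_activation q A fun U => percolationProb p (edgesInside U) A B]
  simp only [chayesMachta, edgesInside_activeVertices]

theorem chayesMachta_mulVec (f : Config G → ℝ) (A : Config G) : (chayesMachta G p q *ᵥ f) A
    = ∑ U, activationProb q A U * percolationOp p (edgesInside U) f A := by
  simp only [mulVec, dotProduct, chayesMachta_apply, percolationOp, mul_sum, sum_mul, mul_assoc]
  exact sum_comm

theorem wInner_chayesMachta (w f g : Config G → ℝ) : ⟪f, chayesMachta G p q *ᵥ g⟫_[ℝ, w]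
    = ∑ U, ⟪f, percolationOp p (edgesInside U) g⟫_[ℝ, fun A => w A * activationProb q A U] := by
  simp only [wInner_eq_sum, chayesMachta_mulVec, mul_sum]
  rw [sum_comm]
  exact sum_congr rfl fun U _ => sum_congr rfl fun A _ => by ring

theorem wInner_eq_sum_activation (q : ℝ) (w f g : Config G → ℝ) : ⟪f, g⟫_[ℝ, w]
    = ∑ U, ⟪f, g⟫_[ℝ, fun A => w A * activationProb q A U] := by
  simp only [wInner_eq_sum]
  rw [sum_comm]
  refine sum_congr rfl fun A _ => ?_
  rw [← sum_mul, ← mul_sum, sum_activationProb, mul_one]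

theorem chayesMachta_mem_rowStochastic (hp : 0 ≤ p) (hp1 : p ≤ 1) (hq : 1 ≤ q) :
    chayesMachta G p q ∈ rowStochastic ℝ (Config G) := by
  refine mem_rowStochastic_iff_sum.2 ⟨fun A B => ?_, fun A => ?_⟩
  · rw [chayesMachta_apply]
    exact sum_nonneg fun U _ => mul_nonneg (activationProb_nonneg hq A U)
      (percolationProb_nonneg hp hp1 _ A B)
  · simp only [chayesMachta_apply]
    rw [sum_comm]
    simp only [← mul_sum, sum_percolationProb, mul_one, sum_activationProb]

theorem chayesMachta_isReversible (hp : 0 < p) (hp1 : p < 1) (hq : 1 ≤ q) :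
    IsReversible (chayesMachta G p q) (gibbs G p q) where
  mem_rowStochastic := chayesMachta_mem_rowStochastic hp.le hp1.le hq
  pos := gibbs_pos hp hp1 (zero_lt_one.trans_le hq)
  sum_eq_one := sum_gibbs hp hp1 (zero_lt_one.trans_le hq)
  balance := balance_of_wInner_mulVec_comm fun f g => by
    rw [wInner_comm _ _ g, wInner_chayesMachta, wInner_chayesMachta]
    refine sum_congr rfl fun U _ => ?_
    rw [wInner_percolationOp_comm fun e he =>
      isCondProb_activation (zero_lt_one.trans_le hq) he, wInner_comm]

theorem dirichletForm_chayesMachta_le_sum_grad (hp : 0 < p) (hp1 : p < 1) (hq : 1 ≤ q)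
    (f : Config G → ℝ) :
    dirichletForm (chayesMachta G p q) (gibbs G p q) f
      ≤ ∑ e, ⟪grad e f, grad e f⟫_[ℝ, fun A => gibbs G p q A * (p * (1 - p))] := by
  have hq0 := zero_lt_one.trans_le hq
  have hvar : 0 ≤ p * (1 - p) := mul_nonneg hp.le (sub_pos.2 hp1).le
  set w : Finset V → Config G → ℝ := fun U A => gibbs G p q A * activationProb q A U with hw
  have hw_nonneg (U : Finset V) (A : Config G) : 0 ≤ w U A :=
    mul_nonneg (gibbs_pos hp hp1 hq0 A).le (activationProb_nonneg hq A U)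
  calc dirichletForm (chayesMachta G p q) (gibbs G p q) f
      = ∑ U, (⟪f, f⟫_[ℝ, w U] - ⟪f, percolationOp p (edgesInside U) f⟫_[ℝ, w U]) := by
        rw [dirichletForm, sum_sub_distrib, ← wInner_eq_sum_activation, ← wInner_chayesMachta]
    _ ≤ ∑ U, ∑ e, ⟪grad e f, grad e f⟫_[ℝ, fun A => w U A * (p * (1 - p))] := by
        refine sum_le_sum fun U _ => (wInner_sub_wInner_percolationOp_le hp.le hp1.le (hw_nonneg U)
          (fun e he => isCondProb_activation hq0 he) f).trans ?_
        exact sum_le_sum_of_subset_of_nonneg (subset_univ _) fun e _ _ =>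
          wInner_self_nonneg (fun A => mul_nonneg (hw_nonneg U A) hvar) _
    _ = ∑ e, ⟪grad e f, grad e f⟫_[ℝ, fun A => gibbs G p q A * (p * (1 - p))] := by
        rw [sum_comm]
        refine sum_congr rfl fun e _ => ?_
        rw [wInner_eq_sum_activation q]
        simp only [hw, mul_right_comm]

theorem dirichletForm_chayesMachta_le [Nonempty G.edgeSet] (hp : 0 < p) (hp1 : p < 1)
    (hq : 1 ≤ q) (f : Config G → ℝ) :
    dirichletForm (chayesMachta G p q) (gibbs G p q) f
      ≤ q * Fintype.card G.edgeSet * dirichletForm (glauber G p q) (gibbs G p q) f := by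
  have hq0 := zero_lt_one.trans_le hq
  calc dirichletForm (chayesMachta G p q) (gibbs G p q) f
      ≤ ∑ e, ⟪grad e f, grad e f⟫_[ℝ, fun A => gibbs G p q A * (p * (1 - p))] :=
        dirichletForm_chayesMachta_le_sum_grad hp hp1 hq f
    _ ≤ ∑ e, q * ⟪grad e f, grad e f⟫_[ℝ, fun A =>
          gibbs G p q A * (heatBathProb G p q A e * (1 - heatBathProb G p q A e))] := by
        refine sum_le_sum fun e _ => ?_
        simp only [wInner_eq_sum, mul_sum]
        refine sum_le_sum fun A _ => ?_
        refine (mul_le_mul_of_nonneg_right (mul_le_mul_of_nonneg_left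
          (mul_one_sub_le_heatBathProb hp hp1 hq A e) (gibbs_pos hp hp1 hq0 A).le)
          (mul_self_nonneg _)).trans_eq ?_
        ring
    _ = q * Fintype.card G.edgeSet * dirichletForm (glauber G p q) (gibbs G p q) f := by
        rw [dirichletForm_glauber hp hp1 hq0, mul_assoc, Fintype.card_mul_expect, mul_sum]

end ChayesMachta

section BurnIn

variable {Ω : Type*} [Fintype Ω] [DecidableEq Ω] {P : Matrix Ω Ω ℝ} {π : Ω → ℝ}

-- By Markov's inequality `f` exceeds `M` after `t` steps with probability at most `δ`.
theorem mixingTime_le_add_of_mulVec_le (hP : P ∈ rowStochastic ℝ Ω) (hπ : ∀ x, 0 ≤ π x)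
    (hπ1 : ∑ x, π x = 1) {f : Ω → ℝ} (hf : ∀ x, 0 ≤ f x) {M δ ε : ℝ} (hM : 0 < M) (hε : 0 ≤ ε)
    {t s : ℕ} (ht : ∀ x, (P ^ t *ᵥ f) x ≤ δ * M)
    (hs : ∀ x, f x ≤ M → tvDist ((P ^ s) x) π ≤ ε) : mixingTime P π (δ + ε) ≤ (t + s : ℕ) := by
  have hPt := pow_mem hP t
  have hPs := pow_mem hP s
  have dichotomy (y : Ω) : tvDist ((P ^ s) y) π ≤ (M⁻¹ • f + fun _ => ε : Ω → ℝ) y := by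
    have hfM : 0 ≤ M⁻¹ * f y := mul_nonneg (inv_nonneg.2 hM.le) (hf y)
    rw [Pi.add_apply, Pi.smul_apply, smul_eq_mul]
    rcases le_or_gt (f y) M with hy | hy
    · exact (hs y hy).trans (le_add_of_nonneg_left hfM)
    · have htv : tvDist ((P ^ s) y) π ≤ 1 := tvDist_le_one
        (fun _ => nonneg_of_mem_rowStochastic hPs) (sum_row_of_mem_rowStochastic hPs y) hπ hπ1
      have hone : 1 ≤ M⁻¹ * f y := (one_le_inv_mul₀ hM).2 hy.le
      linarith
  refine mixingTime_le fun x => ?_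
  calc tvDist ((P ^ (t + s)) x) π
      ≤ (P ^ t *ᵥ fun y => tvDist ((P ^ s) y) π) x := tvDist_pow_add_le hP π t s x
    _ ≤ (P ^ t *ᵥ (M⁻¹ • f + fun _ => ε)) x := mulVec_mono hPt dichotomy x
    _ = M⁻¹ * (P ^ t *ᵥ f) x + ε := by
        rw [mulVec_add, mulVec_smul, Pi.add_apply, mulVec_const hPt, Pi.smul_apply, smul_eq_mul]
    _ ≤ δ + ε := by
        gcongr
        rw [inv_mul_le_iff₀ hM, mul_comm]
        exact ht x

theorem one_sub_one_div_pow_le_exp {K b : ℝ} (hK : 1 ≤ K) {s : ℕ} (hs : K * b ≤ s) :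
    (1 - 1 / K) ^ s ≤ Real.exp (-b) := by
  have hK0 : 0 < K := by linarith
  calc (1 - 1 / K) ^ s ≤ Real.exp (-(1 / K)) ^ s :=
        pow_le_pow_left₀ (sub_nonneg.2 ((div_le_one hK0).2 hK)) (Real.one_sub_le_exp_neg _) s
    _ = Real.exp (-(s / K)) := by
        rw [← Real.exp_nat_mul]
        ring_nf
    _ ≤ Real.exp (-b) := by
        gcongr
        rwa [le_div_iff₀' hK0]

theorem one_sub_one_div_pow_mul_le {m : ℝ} (hm : 1 ≤ m) {t : ℕ}
    (ht : m * Real.log (16 * m) ≤ t) : (1 - 1 / m) ^ t * m ≤ 1 / 16 := by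
  have := one_sub_one_div_pow_le_exp hm ht
  rw [Real.exp_neg, Real.exp_log (by positivity)] at this
  exact (mul_le_mul_of_nonneg_right this (by linarith)).trans_eq (by field_simp)

end BurnIn

section SparseConfigurations

theorem neg_log_one_sub_le {p : ℝ} (hp : 0 ≤ p) (hp2 : p ≤ 1 / 2) : -Real.log (1 - p) ≤ 2 * p := by
  have hp1 : 0 < 1 - p := by linarith
  have hinv : (1 - p)⁻¹ ≤ 1 + 2 * p := by
    rw [inv_le_iff_one_le_mul₀ hp1]
    nlinarith
  have := Real.log_le_sub_one_of_pos (inv_pos.2 hp1)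
  rw [Real.log_inv] at this
  linarith

theorem one_le_log {x : ℝ} (hx : 3 ≤ x) : 1 ≤ Real.log x := by
  rw [Real.le_log_iff_exp_le (by linarith)]
  linarith [Real.exp_one_lt_d9]

variable {V : Type*} [Fintype V] {G : SimpleGraph V} [DecidableRel G.Adj] {p q L : ℝ}

theorem card_edgeSet_le : Fintype.card G.edgeSet ≤ Fintype.card V ^ 2 := by
  rw [← SimpleGraph.edgeFinset_card]
  exact SimpleGraph.card_edgeFinset_le_card_choose_two.trans (Nat.choose_le_pow _ _)

theorem card_edgeSet_mul_card_mul_log_le (hV : 3 ≤ Fintype.card V) :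
    Fintype.card G.edgeSet * Fintype.card V * Real.log (Fintype.card V)
      ≤ (Fintype.card V : ℝ) ^ 3 * Real.log (Fintype.card V) ^ 2 := by
  have hlog := one_le_log (show (3 : ℝ) ≤ Fintype.card V by exact_mod_cast hV)
  have hm : (Fintype.card G.edgeSet : ℝ) ≤ (Fintype.card V : ℝ) ^ 2 := by
    exact_mod_cast card_edgeSet_le
  rw [pow_succ _ 2]
  gcongr
  exact le_self_pow₀ hlog two_ne_zero

variable [Nonempty G.edgeSet]

theorem log_sixteen_mul_card_edgeSet_le (hV : 16 ≤ Fintype.card V) :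
    Real.log (16 * Fintype.card G.edgeSet) ≤ 3 * Real.log (Fintype.card V) := by
  have hcard : 16 * Fintype.card G.edgeSet ≤ Fintype.card V ^ 3 := by
    rw [pow_succ' _ 2]
    exact Nat.mul_le_mul hV card_edgeSet_le
  have : 0 < Fintype.card G.edgeSet := Fintype.card_pos
  calc Real.log (16 * Fintype.card G.edgeSet) ≤ Real.log ((Fintype.card V : ℝ) ^ 3) :=
        Real.log_le_log (by positivity) (by exact_mod_cast hcard)
    _ = 3 * Real.log (Fintype.card V) := by
        rw [Real.log_pow]
        norm_num

theorem card_mul_log_add_two_le (hV : 16 ≤ Fintype.card V) :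
    Fintype.card G.edgeSet * Real.log (16 * Fintype.card G.edgeSet) + 2
      ≤ Fintype.card G.edgeSet * Fintype.card V * Real.log (Fintype.card V) := by
  have hn : (16 : ℝ) ≤ Fintype.card V := by exact_mod_cast hV
  have hm : (1 : ℝ) ≤ Fintype.card G.edgeSet := Nat.one_le_cast.2 Fintype.card_pos
  have hlog16 := log_sixteen_mul_card_edgeSet_le (G := G) hV
  set n := (Fintype.card V : ℝ)
  set m := (Fintype.card G.edgeSet : ℝ)
  have hmlog : 1 ≤ m * Real.log n := one_le_mul_of_one_le_of_one_le hm (one_le_log (by linarith))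
  calc m * Real.log (16 * m) + 2 ≤ m * (3 * Real.log n) + 2 * (m * Real.log n) := by
        gcongr
        linarith
    _ = 5 * (m * Real.log n) := by ring
    _ ≤ n * (m * Real.log n) := by
        gcongr
        linarith
    _ = m * n * Real.log n := by ring

theorem card_mul_neg_log_le (hV : 16 ≤ Fintype.card V) (hp : 0 < p)
    (hpL : p * Fintype.card V ≤ L) {A : Config G}
    (hA : (A.card : ℝ) ≤ 8 * (p * Fintype.card G.edgeSet + 1 / 16)) :
    A.card * -Real.log p
      ≤ 3 * (8 * L + 1) * (Fintype.card V * Real.log (Fintype.card V)) := by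
  have hn : (16 : ℝ) ≤ Fintype.card V := by exact_mod_cast hV
  have hlog := one_le_log (show (3 : ℝ) ≤ Fintype.card V by linarith)
  have hm : (Fintype.card G.edgeSet : ℝ) ≤ (Fintype.card V : ℝ) ^ 2 := by
    exact_mod_cast card_edgeSet_le
  have hm0 : 0 < (Fintype.card G.edgeSet : ℝ) := Nat.cast_pos.2 Fintype.card_pos
  have hlog16 := log_sixteen_mul_card_edgeSet_le (G := G) hV
  set n := (Fintype.card V : ℝ)
  set m := (Fintype.card G.edgeSet : ℝ)
  have hL : 0 ≤ L := le_trans (by positivity) hpL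
  rcases Nat.eq_zero_or_pos A.card with hempty | hnonempty
  · rw [hempty, Nat.cast_zero, zero_mul]
    positivity
  -- A nonempty `A` obeys `hA` only if `p` is not too small.
  have p_not_small : 1 ≤ p * (16 * m) := by
    have : (1 : ℝ) ≤ A.card := Nat.one_le_cast.2 hnonempty
    linarith
  have neg_log_le : -Real.log p ≤ 3 * Real.log n := by
    have := Real.log_nonneg p_not_small
    rw [Real.log_mul hp.ne' (by positivity)] at this
    linarith
  have few_edges : (A.card : ℝ) ≤ (8 * L + 1) * n := by nlinarith
  calc A.card * -Real.log p ≤ A.card * (3 * Real.log n) := by gcongr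
    _ ≤ (8 * L + 1) * n * (3 * Real.log n) := by gcongr
    _ = 3 * (8 * L + 1) * (n * Real.log n) := by ring

theorem exp_neg_le_gibbs (hV : 16 ≤ Fintype.card V) (hp : 0 < p)
    (hp2 : p ≤ 1 / 2) (hpL : p * Fintype.card V ≤ L) (hq : 1 ≤ q) {A : Config G}
    (hA : (A.card : ℝ) ≤ 8 * (p * Fintype.card G.edgeSet + 1 / 16)) :
    Real.exp (-((4 + 26 * L + Real.log q) * (Fintype.card V * Real.log (Fintype.card V))))
      ≤ 1 / 16 * gibbs G p q A := by
  have hp1' : 0 < 1 - p := by linarith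
  have : 0 < q := by linarith
  have hn : (16 : ℝ) ≤ Fintype.card V := by exact_mod_cast hV
  have hlog := one_le_log (show (3 : ℝ) ≤ Fintype.card V by linarith)
  have open_edges := card_mul_neg_log_le hV hp hpL hA
  have hm : (Fintype.card G.edgeSet : ℝ) ≤ (Fintype.card V : ℝ) ^ 2 := by
    exact_mod_cast card_edgeSet_le
  refine le_trans ?_ (mul_le_mul_of_nonneg_left (le_gibbs hp (sub_pos.1 hp1') hq A) (by norm_num))
  rw [← Real.le_log_iff_exp_le (by positivity), Real.log_mul (by norm_num) (by positivity),
    one_div, Real.log_inv, Real.log_div (by positivity) (by positivity),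
    Real.log_mul (by positivity) (by positivity), Real.log_pow, Real.log_pow, Real.log_pow]
  set n := (Fintype.card V : ℝ)
  set m := (Fintype.card G.edgeSet : ℝ)
  have hL : 0 ≤ L := le_trans (by positivity) hpL
  have hnlog : n ≤ n * Real.log n := le_mul_of_one_le_right (by linarith) hlog
  have factor_sixteen : Real.log 16 ≤ n * Real.log n :=
    (Real.log_le_log (by norm_num) hn).trans (le_mul_of_one_le_left (by linarith) (by linarith))
  have closed_edges : m * -Real.log (1 - p) ≤ 2 * L * (n * Real.log n) :=
    calc m * -Real.log (1 - p) ≤ n ^ 2 * (2 * p) :=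
          mul_le_mul hm (neg_log_one_sub_le hp.le hp2)
            (neg_nonneg.2 (Real.log_nonpos hp1'.le (by linarith))) (by positivity)
      _ = 2 * (p * n) * n := by ring
      _ ≤ 2 * L * (n * Real.log n) := by gcongr
  have components : n * Real.log q ≤ n * Real.log n * Real.log q :=
    mul_le_mul_of_nonneg_right hnlog (Real.log_nonneg hq)
  linarith

end SparseConfigurations

section Comparison

variable {V : Type*} [Fintype V] [DecidableEq V] {G : SimpleGraph V} [DecidableRel G.Adj]
  [Nonempty G.edgeSet] {p q : ℝ} {k : ℕ}

theorem poincareInequality_glauber (hp : 0 < p) (hp1 : p < 1) (hq : 1 ≤ q) (hk0 : k ≠ 0)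
    (hk : mixingTimeCM G p q ≤ k) :
    PoincareInequality (glauber G p q) (gibbs G p q) (4 * k * (q * Fintype.card G.edgeSet)) := by
  intro f hf
  have hrev := chayesMachta_isReversible (G := G) hp hp1 hq
  calc ⟪f, f⟫_[ℝ, gibbs G p q]
      ≤ 2 * k / (1 - 2 * (1 / 4)) * dirichletForm (chayesMachta G p q) (gibbs G p q) f :=
        hrev.poincare_of_tvDist_le (by norm_num) hk0 (hrev.tvDist_le_of_mixingTime_le hk) f hf
    _ = 4 * k * dirichletForm (chayesMachta G p q) (gibbs G p q) f := by ring
    _ ≤ 4 * k * (q * Fintype.card G.edgeSet * dirichletForm (glauber G p q) (gibbs G p q) f) := by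
        gcongr
        exact dirichletForm_chayesMachta_le hp hp1 hq f
    _ = 4 * k * (q * Fintype.card G.edgeSet)
          * dirichletForm (glauber G p q) (gibbs G p q) f := by ring

theorem glauber_pow_mulVec_card_le (hp : 0 < p) (hp1 : p < 1) (hq : 1 ≤ q)
    (t : ℕ) (A : Config G) :
    (glauber G p q ^ t *ᵥ fun B => (B.card : ℝ)) A
      ≤ p * Fintype.card G.edgeSet
        + (1 - 1 / (Fintype.card G.edgeSet : ℝ)) ^ t * Fintype.card G.edgeSet := by
  have hP := glauber_mem_rowStochastic (G := G) hp hp1 hq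
  set m := (Fintype.card G.edgeSet : ℝ)
  have hm : 1 ≤ m := Nat.one_le_cast.2 Fintype.card_pos
  have ha : 0 ≤ 1 - 1 / m := sub_nonneg.2 (div_le_one_of_le₀ hm (by linarith))
  have hA : (A.card : ℝ) ≤ m := Nat.cast_le.2 (card_le_univ A)
  have hpm : 0 ≤ p * m := by positivity
  calc (glauber G p q ^ t *ᵥ fun B => (B.card : ℝ)) A
      = (glauber G p q ^ t *ᵥ ((fun _ => p * m) + fun B : Config G => B.card - p * m)) A := by
        congr 2
        funext B
        exact (add_sub_cancel _ _).symm
    _ = p * m + (glauber G p q ^ t *ᵥ fun B => (B.card : ℝ) - p * m) A := by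
        rw [mulVec_add, Pi.add_apply, mulVec_const (pow_mem hP t)]
    _ ≤ p * m + (1 - 1 / m) ^ t * m := by
        gcongr
        exact (pow_mulVec_le_of_mulVec_le hP ha (glauber_mulVec_card_le hp hp1 hq) t A).trans
          (mul_le_mul_of_nonneg_left (by linarith) (pow_nonneg ha t))

theorem mixingTimeGD_le_add (hp : 0 < p) (hp1 : p < 1) (hq : 1 ≤ q) {K : ℝ} (hK : 1 ≤ K)
    (hgap : PoincareInequality (glauber G p q) (gibbs G p q) K) {t s : ℕ}
    (ht : (1 - 1 / (Fintype.card G.edgeSet : ℝ)) ^ t * Fintype.card G.edgeSet ≤ 1 / 16)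
    (hs : ∀ A : Config G, (A.card : ℝ) ≤ 8 * (p * Fintype.card G.edgeSet + 1 / 16) →
      (1 - 1 / K) ^ s ≤ 1 / 16 * gibbs G p q A) :
    mixingTimeGD G p q ≤ (t + s : ℕ) := by
  have hrev := glauber_isReversible (G := G) hp hp1 hq
  rw [mixingTimeGD, show (1 / 4 : ℝ) = 1 / 8 + 1 / 8 by norm_num]
  refine mixingTime_le_add_of_mulVec_le hrev.mem_rowStochastic (fun A => (hrev.pos A).le)
    hrev.sum_eq_one (f := fun A => (A.card : ℝ)) (fun A => Nat.cast_nonneg _)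
    (M := 8 * (p * Fintype.card G.edgeSet + 1 / 16)) (by positivity) (by norm_num)
    (fun A => ?_) fun A hA => ?_
  · linarith [glauber_pow_mulVec_card_le hp hp1 hq t A]
  · refine hrev.tvDist_pow_le hK (wInner_glauber_self_le hp hp1 (by linarith)) hgap s A
      (by norm_num) ((hs A hA).trans_eq (by ring))

theorem exists_mixingTimeGD_le {L : ℝ} (hV : 16 ≤ Fintype.card V) (hp : 0 < p) (hp2 : p ≤ 1 / 2)
    (hpL : p * Fintype.card V ≤ L) (hq : 1 ≤ q) (hk0 : k ≠ 0) (hk : mixingTimeCM G p q ≤ k) :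
    ∃ T : ℕ, mixingTimeGD G p q ≤ T ∧ (T : ℝ) ≤ k * ((1 + 4 * q * (4 + 26 * L + Real.log q))
      * (Fintype.card G.edgeSet * Fintype.card V * Real.log (Fintype.card V))) := by
  have hp1 : p < 1 := by linarith
  have hm1 : (1 : ℝ) ≤ Fintype.card G.edgeSet := Nat.one_le_cast.2 Fintype.card_pos
  have hk1 : (1 : ℝ) ≤ k := Nat.one_le_cast.2 (Nat.one_le_iff_ne_zero.2 hk0)
  have hL : 0 ≤ L := le_trans (by positivity) hpL
  have hlogq := Real.log_nonneg hq
  have hlogn := Real.log_natCast_nonneg (Fintype.card V)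
  have hgap := poincareInequality_glauber hp hp1 hq hk0 hk
  set D := 4 + 26 * L + Real.log q
  set K := 4 * k * (q * Fintype.card G.edgeSet) with hKdef
  set t := ⌈Fintype.card G.edgeSet * Real.log (16 * Fintype.card G.edgeSet)⌉₊
  set s := ⌈K * (D * (Fintype.card V * Real.log (Fintype.card V)))⌉₊
  have hK : 1 ≤ K := by
    have := one_le_mul_of_one_le_of_one_le hk1 (one_le_mul_of_one_le_of_one_le hq hm1)
    linarith
  refine ⟨t + s, mixingTimeGD_le_add hp hp1 hq hK hgap
    (one_sub_one_div_pow_mul_le hm1 (Nat.le_ceil _)) fun A hA =>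
      (one_sub_one_div_pow_le_exp hK (Nat.le_ceil _)).trans
        (exp_neg_le_gibbs hV hp hp2 hpL hq hA), ?_⟩
  have ht : (t : ℝ) ≤ _ + 1 := (Nat.ceil_lt_add_one
    (mul_nonneg (by linarith) (Real.log_nonneg (by linarith)))).le
  have hs : (s : ℝ) ≤ _ + 1 := (Nat.ceil_lt_add_one (by positivity)).le
  have burn_in := card_mul_log_add_two_le (G := G) hV
  set n := (Fintype.card V : ℝ)
  set m := (Fintype.card G.edgeSet : ℝ)
  push_cast
  calc (t : ℝ) + s ≤ m * n * Real.log n + K * (D * (n * Real.log n)) := by linarith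
    _ ≤ k * (m * n * Real.log n) + K * (D * (n * Real.log n)) :=
        add_le_add_left (le_mul_of_one_le_left (by positivity) hk1) _
    _ = k * ((1 + 4 * q * D) * (m * n * Real.log n)) := by
        rw [hKdef]
        ring

theorem mixingTimeGD_le_mixingTimeCM_mul {L : ℝ} (hV : 16 ≤ Fintype.card V) (hp : 0 < p)
    (hp2 : p ≤ 1 / 2) (hpL : p * Fintype.card V ≤ L) (hq : 1 ≤ q) :
    (mixingTimeGD G p q : ℝ≥0∞) ≤ mixingTimeCM G p q
      * ENNReal.ofReal ((1 + 4 * q * (4 + 26 * L + Real.log q))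
        * (Fintype.card G.edgeSet * Fintype.card V * Real.log (Fintype.card V))) := by
  have hk0 : mixingTimeCM G p q ≠ 0 := mixingTime_ne_zero (by norm_num)
  induction hk : mixingTimeCM G p q with
  | top =>
    have hL : 0 ≤ L := le_trans (by positivity) hpL
    have hlogq := Real.log_nonneg hq
    have hlogn : 0 < Real.log (Fintype.card V) := Real.log_pos (by norm_cast; omega)
    have : 0 < (Fintype.card G.edgeSet : ℝ) := Nat.cast_pos.2 Fintype.card_pos
    rw [ENat.toENNReal_top, ENNReal.top_mul]
    · exact le_top
    · rw [Ne, ENNReal.ofReal_eq_zero, not_le]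
      positivity
  | coe k =>
    rw [hk] at hk0
    obtain ⟨T, hT, hTk⟩ := exists_mixingTimeGD_le hV hp hp2 hpL hq (Nat.cast_ne_zero.1 hk0) hk.le
    calc (mixingTimeGD G p q : ℝ≥0∞) ≤ ENNReal.ofReal T := by
          rw [ENNReal.ofReal_natCast, ← ENat.toENNReal_coe]
          exact ENat.toENNReal_mono hT
      _ ≤ _ := ENNReal.ofReal_le_ofReal hTk
      _ = _ := by
          rw [ENNReal.ofReal_mul (Nat.cast_nonneg k), ENNReal.ofReal_natCast, ENat.toENNReal_coe]

end Comparison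

end RandomCluster

theorem theorem2_general.{u} (q : ℝ) (hq : 1 ≤ q) (L : ℝ) (hL : 0 < L) :
    ∃ C : ℝ, 0 < C ∧ ∃ N : ℕ, ∀ (V : Type u) [Fintype V] [DecidableEq V] (G : SimpleGraph V)
      [DecidableRel G.Adj] [Nonempty G.edgeSet], N ≤ Fintype.card V →
      ∀ p : ℝ, 0 < p → p * Fintype.card V ≤ L →
        (RandomCluster.mixingTimeGD G p q : ℝ≥0∞) ≤ (RandomCluster.mixingTimeCM G p q : ℝ≥0∞) *
          ENNReal.ofReal
            (C * (Fintype.card G.edgeSet * Fintype.card V * Real.log (Fintype.card V))) := by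
  have hlogq := Real.log_nonneg hq
  refine ⟨1 + 4 * q * (4 + 26 * L + Real.log q), by positivity, max 16 ⌈2 * L⌉₊,
    fun V _ _ G _ _ hN p hp hpL => ?_⟩
  have hV : 16 ≤ Fintype.card V := (le_max_left _ _).trans hN
  have hVL : 2 * L ≤ Fintype.card V := Nat.ceil_le.1 ((le_max_right _ _).trans hN)
  have hp2 : p ≤ 1 / 2 := by
    have : 0 < (Fintype.card V : ℝ) := by linarith
    nlinarith
  exact RandomCluster.mixingTimeGD_le_mixingTimeCM_mul hV hp hp2 hpL hq

theorem theorem2 (q : ℝ) (hq : 1 < q) (L : ℝ) (hL : 0 < L) :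
    ∃ C : ℝ, 0 < C ∧ ∃ N : ℕ, ∀ n : ℕ, N ≤ n →
      ∀ lam : ℝ, 0 < lam → lam ≤ L → lam < n →
        (RandomCluster.mixingTimeGD (⊤ : SimpleGraph (Fin n)) (lam / n) q : ℝ≥0∞) ≤
          (RandomCluster.mixingTimeCM (⊤ : SimpleGraph (Fin n)) (lam / n) q : ℝ≥0∞) *
            ENNReal.ofReal (C * ((n : ℝ) ^ 3 * Real.log n ^ 2)) := by
  obtain ⟨C, hC, N, hCN⟩ := theorem2_general q hq.le L hL
  refine ⟨C, hC, max 3 N, fun n hn lam hlam hlamL hlamn => ?_⟩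
  obtain ⟨hn3, hnN⟩ := max_le_iff.1 hn
  have hn0 : (0 : ℝ) < n := hlam.trans hlamn
  have : Nontrivial (Fin n) := Fin.nontrivial_iff_two_le.2 (by omega)
  have : Nonempty (⊤ : SimpleGraph (Fin n)).edgeSet :=
    (SimpleGraph.edgeSet_nonempty.2 top_ne_bot).to_subtype
  have hsize := RandomCluster.card_edgeSet_mul_card_mul_log_le
    (G := (⊤ : SimpleGraph (Fin n))) (by simpa using hn3)
  have hbound := hCN (Fin n) ⊤ (by simpa using hnN) (lam / n) (by positivity)
    (by rwa [Fintype.card_fin, div_mul_cancel₀ _ hn0.ne'])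
  rw [Fintype.card_fin] at hsize hbound
  refine hbound.trans ?_
  gcongr
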